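/- Let $(M^n,g)$ be a smooth Riemannian manifold, $n\ge 3$, with Levi-Civita connection $\nabla$, and let $A$ be a Codazzi tensor on $M$, i.e. a smooth self-adjoint $(1,1)$ tensor field with $(\nabla_XA)Y=(\nabla_YA)X$ for all vector fields $X,Y$. Let $U$ be an open neighborhood of a point $p\in M$ on which $A$ has exactly two eigenfunctions $\mu,\lambda$, that is, at every $x\in U$ we have $\mu(x)\neq\lambda(x)$ and these are precisely the eigenvalues of $A_x$. Write $V_\mu,V_\lambda$ for the eigendistributions, and assume that $\dim V_\mu=1$ on $U$ and that $\lambda$ is non-constant near $p$, i.e. not constant on any neighborhood of $p$. Assume that at least one of the following four conditions holds on $U$: 1. $D_Y(\operatorname{tr}A)=0$ for all $Y\in V_\lambda$; 2. $D_Y\mu=0$ for all $Y\in V_\lambda$; 3. the integral curves of $V_\mu$ (parametrized by arc length) are geodesics; 4. every smooth unit vector field $X$ in $V_\mu$ defined on an open subset of $U$ is locally a gradient: near each point of its domain there is a smooth function $f$ with $\nabla f=X$. Then near $p$ the metric is a non-trivial warped product with interval base, consistent with the eigenspace structure of $A$: there are an open interval $I\subseteq\mathbb R$, an $(n-1)$-dimensional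 smooth Riemannian manifold $(N,h)$, a smooth function $F:I\to(0,\infty)$ that is not constant, and a diffeomorphism $\Phi$ from $I\times N$ onto an open neighborhood of $p$ contained in $U$, such that $$\Phi^*g=dt^2+F(t)^2\,h ,$$ and such that for all $(t,y)\in I\times N$ one has $d\Phi(T_tI\times 0)=V_\mu$ and $d\Phi(0\times T_yN)=V_\lambda$ at $\Phi(t,y)$; that is, the slices $I\times\{y\}$ and $\{t\}\times N$ are integral submanifolds of $V_\mu$ and $V_\lambda$. -/

import Mathlib

open Bundle Set Filter VectorField
open scoped Manifold ContDiff Topology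

set_option linter.unusedSectionVars false

noncomputable section
namespace CodazziWarped

variable {E : Type*} [NormedAddCommGroup E] [NormedSpace ℝ E] [FiniteDimensional ℝ E]
  {H : Type*} [TopologicalSpace H] {I : ModelWithCorners ℝ E H}
  {M : Type*} [TopologicalSpace M] [ChartedSpace H M] [IsManifold I ∞ M]
  [RiemannianBundle (fun x : M ↦ TangentSpace I x)]

variable (I) in
/-- Half of the right-hand side of the Koszul formula
`2 ⟨∇_X Y, Z⟩ = X⟨Y, Z⟩ + Y⟨X, Z⟩ - Z⟨X, Y⟩ + ⟨[X, Y], Z⟩ - ⟨[X, Z], Y⟩ - ⟨[Y, Z], X⟩`. -/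
def koszul (X Y Z : Π x : M, TangentSpace I x) (x : M) : ℝ :=
  2⁻¹ * (mvfderiv I (fun y ↦ inner ℝ (Y y) (Z y)) x (X x)
    + mvfderiv I (fun y ↦ inner ℝ (X y) (Z y)) x (Y x)
    - mvfderiv I (fun y ↦ inner ℝ (X y) (Y y)) x (Z x)
    + inner ℝ (mlieBracket I X Y x) (Z x)
    - inner ℝ (mlieBracket I X Z x) (Y x)
    - inner ℝ (mlieBracket I Y Z x) (X x))

variable [IsContMDiffRiemannianBundle I ∞ E (fun x : M ↦ TangentSpace I x)]

theorem mdifferentiableAt_inner {x : M} {X Y : Π x : M, TangentSpace I x}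
    (hX : MDiffAt (T% X) x) (hY : MDiffAt (T% Y) x) : MDiffAt (fun y ↦ inner ℝ (X y) (Y y)) x :=
  MDifferentiableAt.inner_bundle (E := fun x : M ↦ TangentSpace I x) (b := fun y : M ↦ y) hX hY

theorem tensorialAt_koszul_left {x : M} {Y Z : Π x : M, TangentSpace I x}
    (hY : MDiffAt (T% Y) x) (hZ : MDiffAt (T% Z) x) :
    TensorialAt I E (fun X : Π x : M, TangentSpace I x ↦ koszul I X Y Z x) x where
  smul {f X} hf hX := by
    simp only [koszul, Pi.smul_apply', real_inner_smul_left, mvfderiv_fun_mul hf (mdifferentiableAt_inner hX hZ),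
      mvfderiv_fun_mul hf (mdifferentiableAt_inner hX hY), mlieBracket_smul_left hf hX, inner_add_left, real_inner_smul_right]
    simp [real_inner_comm]
    ring
  add {X X'} hX hX' := by
    simp only [koszul, Pi.add_apply, inner_add_left, mvfderiv_fun_add (mdifferentiableAt_inner hX hZ)
      (mdifferentiableAt_inner hX' hZ), mvfderiv_fun_add (mdifferentiableAt_inner hX hY)
      (mdifferentiableAt_inner hX' hY), mlieBracket_add_left hX hX', inner_add_right]
    simp
    ring

theorem tensorialAt_koszul_right {x : M} {X Y : Π x : M, TangentSpace I x}
    (hX : MDiffAt (T% X) x) (hY : MDiffAt (T% Y) x) :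
    TensorialAt I E (fun Z : Π x : M, TangentSpace I x ↦ koszul I X Y Z x) x where
  smul {f Z} hf hZ := by
    simp only [koszul, Pi.smul_apply', real_inner_smul_right, mvfderiv_fun_mul hf (mdifferentiableAt_inner hX hZ),
      mvfderiv_fun_mul hf (mdifferentiableAt_inner hY hZ), mlieBracket_smul_right hf hZ, inner_add_left,
      real_inner_smul_left]
    simp [real_inner_comm]
    ring
  add {Z Z'} hZ hZ' := by
    simp only [koszul, Pi.add_apply, inner_add_right, mvfderiv_fun_add (mdifferentiableAt_inner hX hZ)
      (mdifferentiableAt_inner hX hZ'), mvfderiv_fun_add (mdifferentiableAt_inner hY hZ)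
      (mdifferentiableAt_inner hY hZ'), mlieBracket_add_right hZ hZ', inner_add_left]
    simp
    ring

theorem koszul_add {x : M} {X Y Y' Z : Π x : M, TangentSpace I x} (hX : MDiffAt (T% X) x)
    (hY : MDiffAt (T% Y) x) (hY' : MDiffAt (T% Y') x) (hZ : MDiffAt (T% Z) x) :
    koszul I X (Y + Y') Z x = koszul I X Y Z x + koszul I X Y' Z x := by
  simp only [koszul, Pi.add_apply, inner_add_left, inner_add_right,
    mvfderiv_fun_add (mdifferentiableAt_inner hY hZ) (mdifferentiableAt_inner hY' hZ),
    mvfderiv_fun_add (mdifferentiableAt_inner hX hY) (mdifferentiableAt_inner hX hY'),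
    mlieBracket_add_right hY hY', mlieBracket_add_left hY hY']
  simp
  ring

theorem koszul_smul {x : M} {f : M → ℝ} {X Y Z : Π x : M, TangentSpace I x}
    (hf : MDiffAt f x) (hX : MDiffAt (T% X) x)
    (hY : MDiffAt (T% Y) x) (hZ : MDiffAt (T% Z) x) :
    koszul I X (f • Y) Z x =
      f x * koszul I X Y Z x + mvfderiv I f x (X x) * inner ℝ (Y x) (Z x) := by
  simp only [koszul, Pi.smul_apply', real_inner_smul_left, real_inner_smul_right,
    mvfderiv_fun_mul hf (mdifferentiableAt_inner hY hZ), mvfderiv_fun_mul hf (mdifferentiableAt_inner hX hY),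
    mlieBracket_smul_right hf hY, mlieBracket_smul_left hf hY, inner_add_left]
  simp [real_inner_comm]
  ring

open Classical in
variable (I) in
/-- For a vector field `Y` that is differentiable at `x`, the bilinear form on the tangent space at
`x` that the Koszul formula induces in its arguments `X` and `Z`. -/
def koszulForm (Y : Π x : M, TangentSpace I x) (x : M) :
    TangentSpace I x →L[ℝ] TangentSpace I x →L[ℝ] ℝ :=
  if hY : MDiffAt (T% Y) x then
    TensorialAt.mkHom₂ (fun X Z ↦ koszul I X Y Z x) x
      (fun _ hZ ↦ tensorialAt_koszul_left hY hZ) (fun _ hX ↦ tensorialAt_koszul_right hX hY)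
  else 0

instance instFiniteDimensionalTangentSpace (x : M) : FiniteDimensional ℝ (TangentSpace I x) :=
  inferInstanceAs (FiniteDimensional ℝ E)

instance instCompleteSpaceTangentSpace (x : M) : CompleteSpace (TangentSpace I x) :=
  FiniteDimensional.complete ℝ _

variable (I) in
/-- The map `v ↦ ∇_v Y` at `x`: the vector dual to the Koszul form. -/
def leviCivitaFun (Y : Π x : M, TangentSpace I x) (x : M) :
    TangentSpace I x →L[ℝ] TangentSpace I x :=
  (InnerProductSpace.toDual ℝ (TangentSpace I x)).symm.toContinuousLinearEquiv.toContinuousLinearMap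
    ∘L koszulForm I Y x

theorem inner_leviCivitaFun {x : M} {X Y Z : Π x : M, TangentSpace I x} (hX : MDiffAt (T% X) x)
    (hY : MDiffAt (T% Y) x) (hZ : MDiffAt (T% Z) x) :
    inner ℝ (leviCivitaFun I Y x (X x)) (Z x) = koszul I X Y Z x := by
  rw [leviCivitaFun, koszulForm, dif_pos hY]
  simp [TensorialAt.mkHom₂_apply _ _ hX hZ]

theorem mdifferentiableAt_extend {x : M} (v : TangentSpace I x) :
    MDiffAt (T% (FiberBundle.extend E v)) x :=
  FiberBundle.mdifferentiableAt_extend ..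

theorem leviCivitaFun_eq {x : M} {X Y : Π x : M, TangentSpace I x} (hX : MDiffAt (T% X) x)
    (hY : MDiffAt (T% Y) x) {w : TangentSpace I x}
    (h : ∀ Z : Π x : M, TangentSpace I x, MDiffAt (T% Z) x →
      koszul I X Y Z x = inner ℝ w (Z x)) : leviCivitaFun I Y x (X x) = w := by
  refine ext_inner_right ℝ fun z ↦ ?_
  have := h _ (mdifferentiableAt_extend z)
  rw [← inner_leviCivitaFun hX hY (mdifferentiableAt_extend z)] at this
  simpa using this

variable (I M) in
/-- The Levi-Civita connection of the metric, given by the Koszul formula; on paper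
`leviCivita I M Y x (X x)` is `(∇_X Y)(x)`. -/
def leviCivita : CovariantDerivative I E (fun x : M ↦ TangentSpace I x) where
  toFun := leviCivitaFun I
  isCovariantDerivativeOnUniv :=
    { add := by
        intro Y Y' x hY hY' _
        ext1 u
        have hX := mdifferentiableAt_extend u
        have := leviCivitaFun_eq (w := (leviCivitaFun I Y x + leviCivitaFun I Y' x) u) hX
          (mdifferentiableAt_add_section hY hY') (fun Z hZ ↦ by
            rw [koszul_add hX hY hY' hZ, ← inner_leviCivitaFun hX hY hZ,
              ← inner_leviCivitaFun hX hY' hZ]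
            simp [inner_add_left])
        simpa using this
      leibniz := by
        intro Y f x hY hf _
        ext1 u
        have hX := mdifferentiableAt_extend u
        have := leviCivitaFun_eq
          (w := (f x • leviCivitaFun I Y x + (mvfderiv I f x).smulRight (Y x)) u) hX
          (hf.smul_section hY) (fun Z hZ ↦ by
            rw [koszul_smul hf hX hY hZ, ← inner_leviCivitaFun hX hY hZ]
            simp [inner_add_left, real_inner_smul_left])
        simpa using this }

theorem inner_leviCivita {x : M} {X Y Z : Π x : M, TangentSpace I x} (hX : MDiffAt (T% X) x)
    (hY : MDiffAt (T% Y) x) (hZ : MDiffAt (T% Z) x) :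
    inner ℝ (leviCivita I M Y x (X x)) (Z x) = koszul I X Y Z x :=
  inner_leviCivitaFun hX hY hZ

/-- The Levi-Civita connection is torsion free. -/
theorem leviCivita_torsion : (leviCivita I M).torsion = 0 := by
  rw [CovariantDerivative.torsion_eq_zero_iff]
  intro X Y x hX hY
  refine ext_inner_right ℝ fun z ↦ ?_
  have hZ := mdifferentiableAt_extend z
  have h1 := inner_leviCivita hX hY hZ
  have h2 := inner_leviCivita hY hX hZ
  simp only [FiberBundle.extend_apply_self] at h1 h2
  rw [inner_sub_left, h1, h2, koszul, koszul, mlieBracket_swap_apply (V := Y) (W := X)]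
  simp only [FiberBundle.extend_apply_self, real_inner_comm (Y _) (X _), inner_neg_left]
  ring

/-- The Levi-Civita connection is compatible with the metric. -/
theorem leviCivita_metric {x : M} {X Y Z : Π x : M, TangentSpace I x}
    (hX : MDiffAt (T% X) x) (hY : MDiffAt (T% Y) x) (hZ : MDiffAt (T% Z) x) :
    mvfderiv I (fun y ↦ inner ℝ (Y y) (Z y)) x (X x) =
      inner ℝ (leviCivita I M Y x (X x)) (Z x) + inner ℝ (Y x) (leviCivita I M Z x (X x)) := by
  rw [real_inner_comm _ (Y x), inner_leviCivita hX hY hZ, inner_leviCivita hX hZ hY, koszul, koszul,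
    mlieBracket_swap_apply (V := Z) (W := Y)]
  simp only [real_inner_comm (Y _) (Z _), inner_neg_left]
  ring

/-! ### Gradients, geodesics -/

variable (I) in
/-- The gradient of `f` at `x`: the vector dual to the differential of `f` at `x`. -/
def grad (f : M → ℝ) (x : M) : TangentSpace I x :=
  (InnerProductSpace.toDual ℝ (TangentSpace I x)).symm (mvfderiv I f x)

variable (I) in
/-- The velocity vector of a curve. -/
def velocity (γ : ℝ → M) (t : ℝ) : TangentSpace I (γ t) :=
  mfderiv 𝓘(ℝ, ℝ) I γ t (1 : ℝ)

variable (I) in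
/-- A regular (for instance unit speed) curve `γ` is a geodesic on the open set `J` of times if
`∇_{γ'} γ' = 0` at every time `t ∈ J`. Here `∇_{γ'} γ'` is computed, as usual, by means of any
vector field `X` that is differentiable at `γ t` and extends `γ'` near `t`. -/
def IsGeodesicOn (γ : ℝ → M) (J : Set ℝ) : Prop :=
  ∀ t ∈ J, ∀ X : Π x : M, TangentSpace I x, MDiffAt (T% X) (γ t) →
    (∀ᶠ s in 𝓝 t, X (γ s) = velocity I γ s) →
      leviCivita I M X (γ t) (velocity I γ t) = 0

/-! ### Codazzi tensors and their eigendistributions -/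

/-- A Codazzi tensor: a smooth, self-adjoint `(1,1)` tensor field `A` with
`(∇_X A) Y = (∇_Y A) X` for all vector fields `X`, `Y`,
where `(∇_X A) Y = ∇_X (A Y) - A (∇_X Y)`. -/
structure IsCodazzi (A : Π x : M, TangentSpace I x →L[ℝ] TangentSpace I x) : Prop where
  smooth : ContMDiff I (I.prod 𝓘(ℝ, E →L[ℝ] E)) ∞
    (fun x ↦ TotalSpace.mk' (E →L[ℝ] E)
      (E := fun x : M ↦ TangentSpace I x →L[ℝ] TangentSpace I x) x (A x))
  selfAdjoint : ∀ (x : M) (v w : TangentSpace I x), inner ℝ (A x v) w = inner ℝ v (A x w)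
  codazzi : ∀ (X Y : Π x : M, TangentSpace I x) (x : M), MDiffAt (T% X) x → MDiffAt (T% Y) x →
    leviCivita I M (fun y ↦ A y (Y y)) x (X x) - A x (leviCivita I M Y x (X x)) =
      leviCivita I M (fun y ↦ A y (X y)) x (Y x) - A x (leviCivita I M X x (Y x))

/-- The eigendistribution `V_ν` of the function `ν`: at `x`, all `v` with `A v = ν(x) v`. -/
def eigenDist (A : Π x : M, TangentSpace I x →L[ℝ] TangentSpace I x) (ν : M → ℝ) (x : M) :
    Submodule ℝ (TangentSpace I x) :=
  Module.End.eigenspace (A x : TangentSpace I x →ₗ[ℝ] TangentSpace I x) (ν x)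

/-- The trace of a `(1,1)` tensor field. -/
def trace (A : Π x : M, TangentSpace I x →L[ℝ] TangentSpace I x) (x : M) : ℝ :=
  LinearMap.trace ℝ (TangentSpace I x) (A x : TangentSpace I x →ₗ[ℝ] TangentSpace I x)

/-- On `U`, the tensor field `A` has exactly two eigenfunctions `μ` and `lam`, everywhere
distinct. -/
def HasTwoEigenfunctionsOn (A : Π x : M, TangentSpace I x →L[ℝ] TangentSpace I x)
    (μ lam : M → ℝ) (U : Set M) : Prop :=
  ∀ x ∈ U, μ x ≠ lam x ∧ ∀ r : ℝ,
    Module.End.HasEigenvalue (A x : TangentSpace I x →ₗ[ℝ] TangentSpace I x) r ↔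
      r = μ x ∨ r = lam x

/-- On `U`, the function `f` has vanishing derivative along the eigendistribution of `lam`. -/
def IsConstantAlong (A : Π x : M, TangentSpace I x →L[ℝ] TangentSpace I x)
    (lam : M → ℝ) (U : Set M) (f : M → ℝ) : Prop :=
  ∀ x ∈ U, ∀ v ∈ eigenDist A lam x, mvfderiv I f x v = 0

/-- In `U`, the integral curves (parametrized by arc length) of the eigendistribution of `μ` are
geodesics. -/
def IntegralCurvesAreGeodesics (A : Π x : M, TangentSpace I x →L[ℝ] TangentSpace I x)
    (μ : M → ℝ) (U : Set M) : Prop :=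
  ∀ (γ : ℝ → M) (J : Set ℝ), IsOpen J → J.OrdConnected → ContMDiffOn 𝓘(ℝ, ℝ) I ∞ γ J →
    (∀ t ∈ J, γ t ∈ U ∧ velocity I γ t ∈ eigenDist A μ (γ t) ∧ ‖velocity I γ t‖ = 1) →
      IsGeodesicOn I γ J

/-- Every smooth unit vector field in the eigendistribution of `μ`, defined on an open subset of
`U`, is locally the gradient of a smooth function. -/
def UnitFieldsAreLocallyGradients (A : Π x : M, TangentSpace I x →L[ℝ] TangentSpace I x)
    (μ : M → ℝ) (U : Set M) : Prop :=
  ∀ (X : Π x : M, TangentSpace I x) (W : Set M), IsOpen W → W ⊆ U →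
    ContMDiffOn I I.tangent ∞ (T% X) W → (∀ x ∈ W, X x ∈ eigenDist A μ x ∧ ‖X x‖ = 1) →
      ∀ q ∈ W, ∃ f : M → ℝ, ContMDiffAt I 𝓘(ℝ, ℝ) ∞ f q ∧ ∀ᶠ x in 𝓝 q, grad I f x = X x

/-! ### Warped products -/

section WarpedProduct

variable {E' : Type*} [NormedAddCommGroup E'] [NormedSpace ℝ E']
  {H' : Type*} [TopologicalSpace H'] {I' : ModelWithCorners ℝ E' H'}
  {N : Type*} [TopologicalSpace N] [ChartedSpace H' N] [IsManifold I' ∞ N]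

variable (I I') in
/-- The differential of a map from the product of the real line and `N`, as a function of a pair
consisting of a vector `a` tangent to the line and a vector `v` tangent to `N`. -/
def prodDeriv (Φ : ℝ × N → M) (t : ℝ) (y : N) (a : ℝ) (v : TangentSpace I' y) :
    TangentSpace I (Φ (t, y)) :=
  mfderiv (𝓘(ℝ, ℝ).prod I') I Φ (t, y) ((a, v) : ℝ × E')

/-- `Φ` identifies the open set `Φ.target` of `M` with the warped product `J ×_F N` with base an
open interval `J`, fibre the Riemannian manifold `(N, h)` and warping function `F`. That is, `Φ` is
a diffeomorphism from `J × N` onto `Φ.target`, and it pulls the metric of `M` back to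
`dt² + F(t)² h`. -/
structure IsWarpedProduct (J : Set ℝ) (F : ℝ → ℝ)
    (h : ContMDiffRiemannianMetric I' ∞ E' (fun y : N ↦ TangentSpace I' y))
    (Φ : OpenPartialHomeomorph (ℝ × N) M) : Prop where
  isOpen_base : IsOpen J
  ordConnected_base : J.OrdConnected
  warping_smooth : ContDiffOn ℝ ∞ F J
  warping_pos : ∀ t ∈ J, 0 < F t
  source_eq : Φ.source = J ×ˢ univ
  smooth : ContMDiffOn (𝓘(ℝ, ℝ).prod I') I ∞ Φ Φ.source
  smooth_symm : ContMDiffOn I (𝓘(ℝ, ℝ).prod I') ∞ Φ.symm Φ.target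
  metric_eq : ∀ t ∈ J, ∀ (y : N) (a b : ℝ) (v w : TangentSpace I' y),
    inner ℝ (prodDeriv I I' Φ t y a v) (prodDeriv I I' Φ t y b w) =
      a * b + F t ^ 2 * h.inner y v w

/-- The product structure `Φ` is consistent with the eigenspace structure of `A`: the slices
`J × {y}` and `{t} × N` are integral submanifolds of the eigendistributions of `μ` and `lam`. -/
def IsConsistent (A : Π x : M, TangentSpace I x →L[ℝ] TangentSpace I x) (μ lam : M → ℝ)
    (I' : ModelWithCorners ℝ E' H') (J : Set ℝ) (Φ : ℝ × N → M) : Prop :=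
  ∀ t ∈ J, ∀ y : N,
    range (fun a : ℝ ↦ prodDeriv I I' Φ t y a 0) = eigenDist A μ (Φ (t, y)) ∧
    range (fun v : TangentSpace I' y ↦ prodDeriv I I' Φ t y 0 v) = eigenDist A lam (Φ (t, y))

end WarpedProduct

end CodazziWarped
end

/-! Let `T` be a local unit field in V_μ, so that V_λ is its orthogonal complement, of dimension n −
1 ≥ 2. Pairing the Codazzi equation for two orthogonal fields in V_λ with one of them shows that λ
is constant along V_λ (`mvfderiv_lam_eq_zero`). For `T` and v, w in V_λ the equation splits
(`codazzi_components`) into (μ − λ)⟨v, ∇_T T⟩ = v(μ) and (μ − λ)⟨∇_v T, w⟩ = T(λ)⟨v, w⟩.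

Each of the four conditions therefore gives v(μ) = 0 on V_λ: the trace is μ + (n − 1)λ; unit speed
integral curves are geodesics only if ∇_T T = 0; and if `T` is a gradient then ∇T is symmetric, so
⟨∇_T T, v⟩ = ⟨∇_v T, T⟩ = 0.

Once v(μ) = 0, ∇T is η times the projection onto V_λ, with η = T(λ)/(μ − λ)
(`inner_leviCivita_unit_field`). This is symmetric, so the one-form dual to `T` is closed, and `T`
and the form are straightened together (`exists_rectification`): there are coordinates (t, y) with T
= ∂_t and dual form dt, whose slices t = const are tangent to V_λ. In them λ, μ and hence η depend
on t alone, and the metric coefficients of the slices satisfy ∂_t g = 2ηg. Hence g(t, y) = F(t)²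
g(0, y) with F'/F = η (`hasDerivAt_gram`, `gram_eq`). If F were constant, then T(λ) = 0 and λ would
be constant near p.

Two analytic facts are needed. Flows are smooth in time and initial value, by the inverse function
theorem for the Picard map on continuous curves (`exists_local_flow`). The eigenfunctions, which are
not assumed smooth, are so because μ − λ is a rational function of the traces of A, A² and A³
(`eigenvalue_sub_eq`). -/

noncomputable section
namespace CodazziWarped

/-! ### Superposition operators on spaces of continuous maps -/

section Superposition

universe u
variable {K : Type*} [TopologicalSpace K] [CompactSpace K]
  {E F : Type u} [NormedAddCommGroup E] [NormedSpace ℝ E] [NormedAddCommGroup F] [NormedSpace ℝ F]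

set_option synthInstance.maxHeartbeats 200000 in
instance instNormedAddCommGroupContinuousMapCLM : NormedAddCommGroup C(K, E →L[ℝ] F) :=
  inferInstance

set_option synthInstance.maxHeartbeats 200000 in
instance instNormedSpaceContinuousMapCLM : NormedSpace ℝ C(K, E →L[ℝ] F) :=
  inferInstance

/-- Pointwise application of a continuous family of continuous linear maps to a continuous map. -/
def pointwiseApply : C(K, E →L[ℝ] F) →L[ℝ] C(K, E) →L[ℝ] C(K, F) :=
  LinearMap.mkContinuous₂
    (LinearMap.mk₂ ℝ (fun (L : C(K, E →L[ℝ] F)) (γ : C(K, E)) ↦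
        (⟨fun k ↦ L k (γ k), L.continuous.clm_apply γ.continuous⟩ : C(K, F)))
      (fun _ _ _ ↦ by ext; simp) (fun _ _ _ ↦ by ext; simp)
      (fun _ _ _ ↦ by ext; simp) (fun _ _ _ ↦ by ext; simp)) 1 (fun L γ ↦ by
    rw [ContinuousMap.norm_le _ (by positivity), one_mul]
    exact fun k ↦ (L k).le_of_opNorm_le_of_le (L.norm_coe_le_norm k) (γ.norm_coe_le_norm k))

@[simp] theorem pointwiseApply_apply (L : C(K, E →L[ℝ] F)) (γ : C(K, E)) (k : K) :
    pointwiseApply L γ k = L k (γ k) := rfl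

/-- The range of `γ` is compact, so `f'` is uniformly continuous near it; the mean value inequality
on the ball around `γ k` then bounds the remainder by ε‖h‖ with the same δ for every `k`. -/
theorem hasFDerivAt_superposition (f : C(E, F)) (f' : C(E, E →L[ℝ] F))
    (hf : ∀ x, HasFDerivAt f (f' x) x) (γ : C(K, E)) :
    HasFDerivAt (fun γ : C(K, E) ↦ f.comp γ) (pointwiseApply (f'.comp γ)) γ := by
  rw [hasFDerivAt_iff_isLittleO_nhds_zero, Asymptotics.isLittleO_iff]
  intro ε hε
  have hu := (isCompact_range γ.continuous).uniformContinuousAt_of_continuousAt f'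
    (fun x _ ↦ f'.continuous.continuousAt) (Metric.dist_mem_uniformity hε)
  obtain ⟨δ, hδ, hδ'⟩ := Metric.mem_uniformity_dist.1 hu
  filter_upwards [Metric.ball_mem_nhds (0 : C(K, E)) hδ] with h hh
  rw [mem_ball_zero_iff] at hh
  rw [ContinuousMap.norm_le _ (by positivity)]
  intro k
  have hk : ‖h k‖ < δ := (h.norm_coe_le_norm k).trans_lt hh
  have key := (convex_ball (γ k) δ).norm_image_sub_le_of_norm_hasFDerivWithin_le' (f := f)
    (f' := f') (φ := f' (γ k)) (C := ε) (x := γ k) (y := γ k + h k)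
    (fun x _ ↦ (hf x).hasFDerivWithinAt)
    (fun x hx ↦ by
      have := hδ' (a := γ k) (b := x) (by rwa [dist_comm]) ⟨k, rfl⟩
      rw [← dist_eq_norm, dist_comm]
      exact le_of_lt this)
    (Metric.mem_ball_self hδ) (by simpa using hk)
  simp only [add_sub_cancel_left] at key
  exact key.trans (mul_le_mul_of_nonneg_left (h.norm_coe_le_norm k) hε.le)

/-- Induction on `n`: the derivative is superposition by `f'` followed by a bounded linear
operation. The target `F` varies in the induction because `f'` takes values in `E →L[ℝ] F`. -/
theorem contDiff_superposition_nat (n : ℕ) : ∀ {F : Type u} [NormedAddCommGroup F]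
    [NormedSpace ℝ F] (f : C(E, F)), ContDiff ℝ n f →
    ContDiff ℝ n (fun γ : C(K, E) ↦ f.comp γ) := by
  induction n with
  | zero =>
    intro F _ _ f _
    exact contDiff_zero.2 (ContinuousMap.continuous_postcomp f)
  | succ n ih =>
    intro F _ _ f hf
    push_cast at hf ⊢
    obtain ⟨f', hf', hff'⟩ := contDiff_succ_iff_hasFDerivAt.1 hf
    refine contDiff_succ_iff_hasFDerivAt.2 ⟨fun γ ↦ pointwiseApply
      ((⟨f', hf'.continuous⟩ : C(E, E →L[ℝ] F)).comp γ), ?_, fun γ ↦ ?_⟩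
    · exact pointwiseApply.contDiff.comp (ih ⟨f', hf'.continuous⟩ hf')
    · exact hasFDerivAt_superposition f ⟨f', hf'.continuous⟩ hff' γ

/-- Composition with a smooth map is a smooth operation on continuous maps. -/
theorem contDiff_superposition (f : C(E, F)) (hf : ContDiff ℝ ∞ f) :
    ContDiff ℝ ∞ (fun γ : C(K, E) ↦ f.comp γ) :=
  contDiff_infty.2 fun n ↦ contDiff_superposition_nat n f (contDiff_infty.1 hf n)

end Superposition

/-! ### The smooth inverse function theorem on an open set -/

/-- Invertible operators form an open set, so the source can be shrunk until the derivative is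
invertible at each of its points; the inverse is then smooth on the whole target, not only at the
image of `a`. -/
theorem exists_openPartialHomeomorph_of_contDiffOn {E F : Type*} [NormedAddCommGroup E]
    [NormedSpace ℝ E] [CompleteSpace E] [NormedAddCommGroup F] [NormedSpace ℝ F]
    {f : E → F} {U : Set E} (hU : IsOpen U) (hf : ContDiffOn ℝ ∞ f U) {a : E} (ha : a ∈ U)
    (f' : E ≃L[ℝ] F) (hf' : HasFDerivAt f (f' : E →L[ℝ] F) a) :
    ∃ e : OpenPartialHomeomorph E F, ⇑e = f ∧ a ∈ e.source ∧ e.source ⊆ U ∧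
      ContDiffOn ℝ ∞ e.symm e.target := by
  have hfa := hf.contDiffAt (hU.mem_nhds ha)
  set e₀ := hfa.toOpenPartialHomeomorph f hf' (by simp) with he₀
  have ha₀ : a ∈ e₀.source := hfa.mem_toOpenPartialHomeomorph_source hf' (by simp)
  have hcont : ContinuousOn (fderiv ℝ f) U := hf.continuousOn_fderiv_of_isOpen hU (by simp)
  have hV : IsOpen (U ∩ fderiv ℝ f ⁻¹' (range ((↑) : (E ≃L[ℝ] F) → E →L[ℝ] F))) :=
    hcont.isOpen_inter_preimage hU (ContinuousLinearEquiv.isOpen (𝕜 := ℝ) (E := E) (F := F))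
  set V := U ∩ fderiv ℝ f ⁻¹' (range ((↑) : (E ≃L[ℝ] F) → E →L[ℝ] F)) with hVdef
  have haV : a ∈ V := ⟨ha, f', hf'.fderiv.symm⟩
  refine ⟨e₀.restrOpen V hV, rfl, ⟨ha₀, haV⟩, fun x hx ↦ hx.2.1, fun y hy ↦ ?_⟩
  have hx := (e₀.restrOpen V hV).map_target hy
  set x := (e₀.restrOpen V hV).symm y with hxy
  obtain ⟨-, hxU, L, hL⟩ := hx
  have hfx := hf.contDiffAt (hU.mem_nhds hxU)
  refine ((e₀.restrOpen V hV).contDiffAt_symm hy (f₀' := L) ?_ ?_).contDiffWithinAt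
  · rw [hL]
    exact (hfx.differentiableAt (by simp)).hasFDerivAt
  · exact hfx

/-! ### Smooth local flows of smooth vector fields -/

section Flow

open MeasureTheory intervalIntegral
open scoped NNReal

universe u
variable {E : Type u} [NormedAddCommGroup E] [NormedSpace ℝ E] [CompleteSpace E]

theorem neg_one_le_one_real : (-1 : ℝ) ≤ 1 := by norm_num

theorem continuous_iccExtend_continuousMap (γ : C(Icc (-1 : ℝ) 1, E)) :
    Continuous (IccExtend neg_one_le_one_real γ) := γ.continuous.Icc_extend'

/-- The Volterra operator: the primitive vanishing at `0` of a curve on `[-1, 1]`. -/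
def volterra : C(Icc (-1 : ℝ) 1, E) →L[ℝ] C(Icc (-1 : ℝ) 1, E) :=
  LinearMap.mkContinuous
    { toFun := fun γ ↦ ⟨fun s ↦ ∫ r in (0 : ℝ)..s, IccExtend neg_one_le_one_real γ r,
        (continuous_primitive (fun _ _ ↦
          (continuous_iccExtend_continuousMap γ).intervalIntegrable _ _) 0).comp
            continuous_subtype_val⟩
      map_add' := fun γ δ ↦ by
        ext s
        exact integral_add ((continuous_iccExtend_continuousMap γ).intervalIntegrable _ _)
          ((continuous_iccExtend_continuousMap δ).intervalIntegrable _ _)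
      map_smul' := fun c γ ↦ by
        ext s
        exact integral_smul c (IccExtend neg_one_le_one_real γ) } 1 (fun γ ↦ by
    rw [ContinuousMap.norm_le _ (by positivity), one_mul]
    intro s
    refine (norm_integral_le_of_norm_le_const (C := ‖γ‖)
      fun r _ ↦ γ.norm_coe_le_norm _).trans ?_
    have : |(s : ℝ) - 0| ≤ 1 := by
      rw [sub_zero, abs_le]; exact s.2
    exact mul_le_of_le_one_right (norm_nonneg _) this)

theorem volterra_apply (γ : C(Icc (-1 : ℝ) 1, E)) (s : Icc (-1 : ℝ) 1) :
    volterra γ s = ∫ r in (0 : ℝ)..s, IccExtend neg_one_le_one_real γ r := rfl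

/-- A fixed point of the Picard operator of `ε • X` solves the differential equation. -/
theorem hasDerivAt_of_picard_eq {X : C(E, E)} {ε : ℝ} {x : E} {γ : C(Icc (-1 : ℝ) 1, E)}
    (hγ : γ - ContinuousMap.const _ x - ε • volterra (X.comp γ) = 0) :
    ∃ σ : ℝ → E, (∀ s : Icc (-1 : ℝ) 1, σ s = γ s) ∧ σ 0 = x ∧
      ∀ s ∈ Icc (-1 : ℝ) 1, HasDerivAt σ (ε • X (σ s)) s := by
  have hval : ∀ s : Icc (-1 : ℝ) 1,
      x + ε • ∫ r in (0 : ℝ)..s, IccExtend neg_one_le_one_real (X.comp γ) r = γ s := fun s ↦ by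
    have := DFunLike.congr_fun hγ s
    simp only [ContinuousMap.sub_apply, ContinuousMap.const_apply, ContinuousMap.smul_apply,
      volterra_apply, ContinuousMap.zero_apply] at this
    rw [sub_sub, sub_eq_zero] at this
    exact this.symm
  -- The integrand is extended by constants beyond [-1, 1], so that the primitive has two-sided
  -- derivatives at the endpoints as well.
  refine ⟨fun s ↦ x + ε • ∫ r in (0 : ℝ)..s, IccExtend neg_one_le_one_real (X.comp γ) r,
    hval, by simp, fun s hs ↦ ?_⟩
  have h := (((continuous_iccExtend_continuousMap (X.comp γ)).integral_hasStrictDerivAt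
    0 s).hasDerivAt.const_smul ε).const_add x
  rw [IccExtend_of_mem _ _ hs, ContinuousMap.comp_apply, ← hval ⟨s, hs⟩] at h
  exact h

/-- Two curves with velocity `ε • X` and `ε' • X` are reparametrisations of each other. -/
theorem eq_of_hasDerivAt_smul {X : E → E} {k : ℝ≥0} (hX : LipschitzWith k X) {δ t : ℝ}
    (hδ : 0 < δ) (ht : |t| ≤ δ) {σ τ : ℝ → E} (h0 : σ 0 = τ 0)
    (hσ : ∀ s ∈ Icc (-1 : ℝ) 1, HasDerivAt σ (t • X (σ s)) s)
    (hτ : ∀ s ∈ Icc (-1 : ℝ) 1, HasDerivAt τ (δ • X (τ s)) s) : σ 1 = τ (t / δ) := by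
  have hts : ∀ s ∈ Icc (0 : ℝ) 1, s * (t / δ) ∈ Icc (-1 : ℝ) 1 := fun s hs ↦ by
    rw [mem_Icc, ← abs_le, abs_mul, abs_div, abs_of_pos hδ, abs_of_nonneg hs.1]
    have : |t| / δ ≤ 1 := (div_le_one hδ).2 ht
    exact mul_le_one₀ hs.2 (by positivity) this
  have hsub : Icc (0 : ℝ) 1 ⊆ Icc (-1) 1 := Icc_subset_Icc_left (by norm_num)
  have hτ' : ∀ s ∈ Icc (0 : ℝ) 1,
      HasDerivAt (fun s ↦ τ (s * (t / δ))) (t • X (τ (s * (t / δ)))) s := fun s hs ↦ by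
    have := (hτ _ (hts s hs)).scomp s ((hasDerivAt_id s).mul_const (t / δ))
    rw [smul_smul, one_mul, div_mul_cancel₀ _ hδ.ne'] at this
    exact this
  -- Both `σ` and the rescaled `τ` solve y' = t X(y) on [0, 1] with the same initial value.
  have huniq := ODE_solution_unique (v := fun _ y ↦ t • X y) (K := ‖t‖₊ * k) (f := σ)
    (g := fun s ↦ τ (s * (t / δ))) (a := 0) (b := 1)
    (fun _ ↦ (lipschitzWith_smul t).comp hX)
    (fun s hs ↦ (hσ s (hsub hs)).continuousAt.continuousWithinAt)
    (fun s hs ↦ (hσ s (hsub (Ico_subset_Icc_self hs))).hasDerivWithinAt)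
    (fun s hs ↦ (hτ' s hs).continuousAt.continuousWithinAt)
    (fun s hs ↦ (hτ' s (Ico_subset_Icc_self hs)).hasDerivWithinAt)
    (by simpa using h0)
  simpa using huniq (right_mem_Icc.2 zero_le_one)

/-- The Picard operator, with the time scale and the initial value as parameters. -/
def picardMap (X : C(E, E)) (z : ℝ × E × C(Icc (-1 : ℝ) 1, E)) :
    ℝ × E × C(Icc (-1 : ℝ) 1, E) :=
  (z.1, z.2.1, z.2.2 - ContinuousMap.const _ z.2.1 - z.1 • volterra (X.comp z.2.2))

/-- Constant curves. -/
def constCurve : E →L[ℝ] C(Icc (-1 : ℝ) 1, E) :=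
  LinearMap.mkContinuous
    { toFun := fun x ↦ ContinuousMap.const _ x
      map_add' := fun _ _ ↦ rfl
      map_smul' := fun _ _ ↦ rfl } 1 fun x ↦ by
    rw [ContinuousMap.norm_le _ (by positivity), one_mul]
    exact fun _ ↦ le_rfl

theorem constCurve_eq (x : E) : constCurve x = ContinuousMap.const _ x := rfl

theorem contDiff_picardMap {X : C(E, E)} (hX : ContDiff ℝ ∞ X) :
    ContDiff ℝ ∞ (picardMap X) := by
  have h1 : ContDiff ℝ ∞ (fun z : ℝ × E × C(Icc (-1 : ℝ) 1, E) ↦ X.comp z.2.2) :=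
    (contDiff_superposition X hX).comp (contDiff_snd.comp contDiff_snd)
  have h2 : ContDiff ℝ ∞ (fun z : ℝ × E × C(Icc (-1 : ℝ) 1, E) ↦ constCurve z.2.1) :=
    (constCurve (E := E)).contDiff.comp (contDiff_fst.comp contDiff_snd)
  exact contDiff_fst.prodMk ((contDiff_fst.comp contDiff_snd).prodMk
    (((contDiff_snd.comp contDiff_snd).sub h2).sub
      (contDiff_fst.smul ((volterra (E := E)).contDiff.comp h1))))

/-- The derivative of the Picard operator at time scale `0`. -/
def picardDeriv (w : C(Icc (-1 : ℝ) 1, E)) :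
    (ℝ × E × C(Icc (-1 : ℝ) 1, E)) ≃L[ℝ] (ℝ × E × C(Icc (-1 : ℝ) 1, E)) :=
  ContinuousLinearEquiv.equivOfInverse
    ((ContinuousLinearMap.fst ℝ _ _).prod (((ContinuousLinearMap.fst ℝ _ _).comp
      (ContinuousLinearMap.snd ℝ _ _)).prod
      ((ContinuousLinearMap.snd ℝ _ _).comp (ContinuousLinearMap.snd ℝ _ _)
        - constCurve.comp ((ContinuousLinearMap.fst ℝ _ _).comp (ContinuousLinearMap.snd ℝ _ _))
        - (ContinuousLinearMap.fst ℝ _ _).smulRight w)))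
    ((ContinuousLinearMap.fst ℝ _ _).prod (((ContinuousLinearMap.fst ℝ _ _).comp
      (ContinuousLinearMap.snd ℝ _ _)).prod
      ((ContinuousLinearMap.snd ℝ _ _).comp (ContinuousLinearMap.snd ℝ _ _)
        + constCurve.comp ((ContinuousLinearMap.fst ℝ _ _).comp (ContinuousLinearMap.snd ℝ _ _))
        + (ContinuousLinearMap.fst ℝ _ _).smulRight w)))
    (fun z ↦ by ext <;> simp; abel) (fun z ↦ by ext <;> simp; abel)

/-- The nonlinear term carries the factor `z.1`, which vanishes at the base point. Only the value of
the Volterra term survives there, and its derivative never has to be computed. -/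
theorem hasFDerivAt_picardMap {X : C(E, E)} (hX : ContDiff ℝ ∞ X) (x : E) :
    HasFDerivAt (picardMap X) (picardDeriv (volterra (X.comp (constCurve x))) :
      (ℝ × E × C(Icc (-1 : ℝ) 1, E)) →L[ℝ] (ℝ × E × C(Icc (-1 : ℝ) 1, E)))
      (0, x, constCurve x) := by
  have h1 : DifferentiableAt ℝ (fun z : ℝ × E × C(Icc (-1 : ℝ) 1, E) ↦ volterra (X.comp z.2.2))
      (0, x, constCurve x) :=
    ((volterra.contDiff.comp ((contDiff_superposition X hX).comp
      (contDiff_snd.comp contDiff_snd))).differentiable (by simp)) _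
  have hA : HasFDerivAt (fun z : ℝ × E × C(Icc (-1 : ℝ) 1, E) ↦ z.2.2)
    ((ContinuousLinearMap.snd ℝ _ _).comp (ContinuousLinearMap.snd ℝ _ _)) (0, x, constCurve x) :=
    ((ContinuousLinearMap.snd ℝ E C(Icc (-1 : ℝ) 1, E)).comp
      (ContinuousLinearMap.snd ℝ ℝ (E × C(Icc (-1 : ℝ) 1, E)))).hasFDerivAt
  have hB : HasFDerivAt (fun z : ℝ × E × C(Icc (-1 : ℝ) 1, E) ↦ z.2.1)
    ((ContinuousLinearMap.fst ℝ _ _).comp (ContinuousLinearMap.snd ℝ _ _)) (0, x, constCurve x) :=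
    ((ContinuousLinearMap.fst ℝ E C(Icc (-1 : ℝ) 1, E)).comp
      (ContinuousLinearMap.snd ℝ ℝ (E × C(Icc (-1 : ℝ) 1, E)))).hasFDerivAt
  have hC : HasFDerivAt (fun z : ℝ × E × C(Icc (-1 : ℝ) 1, E) ↦ z.1)
    (ContinuousLinearMap.fst ℝ _ _) (0, x, constCurve x) :=
    (ContinuousLinearMap.fst ℝ ℝ (E × C(Icc (-1 : ℝ) 1, E))).hasFDerivAt
  have h := hC.prodMk (hB.prodMk ((hA.sub ((constCurve.hasFDerivAt).comp _ hB)).sub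
    (hC.smul h1.hasFDerivAt)))
  refine h.congr_fderiv ?_
  ext z <;> simp [picardDeriv]

/-- A globally smooth and Lipschitz vector field has a smooth local flow. -/
theorem exists_local_flow_of_lipschitz {X : E → E} (hX : ContDiff ℝ ∞ X) {k : ℝ≥0}
    (hk : LipschitzWith k X) (x₀ : E) :
    ∃ (δ : ℝ) (φ : ℝ × E → E), 0 < δ ∧ ContDiffOn ℝ ∞ φ (Ioo (-δ) δ ×ˢ Metric.ball x₀ δ) ∧
      (∀ x ∈ Metric.ball x₀ δ, φ (0, x) = x) ∧
      ∀ t ∈ Ioo (-δ) δ, ∀ x ∈ Metric.ball x₀ δ,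
        HasDerivAt (fun s ↦ φ (s, x)) (X (φ (t, x))) t := by
  set X' : C(E, E) := ⟨X, hX.continuous⟩ with hX'
  have hXX' : ContDiff ℝ ∞ X' := hX
  -- Since the Picard map keeps time scale and initial value as components, its local inverse solves
  -- the fixed point equation smoothly in these parameters: the implicit function theorem in the
  -- form of the inverse function theorem.
  obtain ⟨e, he, hsrc, -, hsymm⟩ := exists_openPartialHomeomorph_of_contDiffOn isOpen_univ
    (contDiff_picardMap hXX').contDiffOn (mem_univ (0, x₀, constCurve x₀)) _
    (hasFDerivAt_picardMap hXX' x₀)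
  have htgt : ((0 : ℝ), x₀, (0 : C(Icc (-1 : ℝ) 1, E))) ∈ e.target := by
    have := e.map_source hsrc
    rw [he] at this
    simpa [picardMap, constCurve_eq] using this
  have hnhds : ∀ᶠ q : ℝ × E in 𝓝 (0, x₀), (q.1, q.2, (0 : C(Icc (-1 : ℝ) 1, E))) ∈ e.target := by
    have hc : Continuous (fun q : ℝ × E ↦ (q.1, q.2, (0 : C(Icc (-1 : ℝ) 1, E)))) := by fun_prop
    exact hc.continuousAt.eventually (e.open_target.mem_nhds htgt)
  obtain ⟨d, hd, hdball⟩ := Metric.eventually_nhds_iff_ball.1 hnhds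
  -- Half the radius, so that the closed range |t| ≤ δ is admissible; the value t = δ itself is
  -- needed for the reference curve below.
  set δ := d / 2 with hδdef
  have hδ : 0 < δ := by positivity
  have hmem : ∀ t x, |t| ≤ δ → x ∈ Metric.ball x₀ δ →
      (t, x, (0 : C(Icc (-1 : ℝ) 1, E))) ∈ e.target := fun t x ht hx ↦ by
    refine hdball (t, x) ?_
    rw [← ball_prod_same]
    refine ⟨?_, Metric.ball_subset_ball (by linarith) hx⟩
    rw [Metric.mem_ball, Real.dist_0_eq_abs]
    linarith
  -- `Γ (t, x)` is the curve on [-1, 1] that starts at `x` at time 0 with velocity `t • X`; its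
  -- value at 1 is the flow at time `t`.
  set Γ : ℝ × E → C(Icc (-1 : ℝ) 1, E) := fun q ↦ (e.symm (q.1, q.2, 0)).2.2 with hΓ
  have hΓeq : ∀ t x, |t| ≤ δ → x ∈ Metric.ball x₀ δ →
      Γ (t, x) - ContinuousMap.const _ x - t • volterra (X'.comp (Γ (t, x))) = 0 := by
    intro t x ht hx
    have h := e.right_inv (hmem t x ht hx)
    rw [he] at h
    simp only [picardMap, Prod.mk.injEq] at h
    obtain ⟨h1, h2, h3⟩ := h
    rw [h1, h2] at h3
    exact h3
  have hΓsmooth : ContDiffOn ℝ ∞ Γ (Ioo (-δ) δ ×ˢ Metric.ball x₀ δ) := by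
    have h1 : ContDiffOn ℝ ∞ (fun q : ℝ × E ↦ e.symm (q.1, q.2, 0))
        (Ioo (-δ) δ ×ˢ Metric.ball x₀ δ) :=
      hsymm.comp (contDiff_fst.prodMk (contDiff_snd.prodMk contDiff_const)).contDiffOn
        fun q hq ↦ hmem q.1 q.2 (abs_lt.2 hq.1).le hq.2
    exact (contDiff_snd.comp contDiff_snd).comp_contDiffOn h1
  have h1mem : (1 : ℝ) ∈ Icc (-1 : ℝ) 1 := ⟨neg_one_le_one_real, le_rfl⟩
  -- For fixed `x`, all time scales are read off one curve `τ` of scale `δ`, which makes the flow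
  -- differentiable in `t` with the right velocity.
  have hflow : ∀ x ∈ Metric.ball x₀ δ, ∃ τ : ℝ → E, τ 0 = x ∧
      (∀ s ∈ Icc (-1 : ℝ) 1, HasDerivAt τ (δ • X (τ s)) s) ∧
      ∀ t, |t| ≤ δ → Γ (t, x) ⟨1, h1mem⟩ = τ (t / δ) := by
    intro x hx
    obtain ⟨τ, -, hτ0, hτ⟩ := hasDerivAt_of_picard_eq (hΓeq δ x (abs_of_pos hδ).le hx)
    refine ⟨τ, hτ0, hτ, fun t ht ↦ ?_⟩
    obtain ⟨σ, hσΓ, hσ0, hσ⟩ := hasDerivAt_of_picard_eq (hΓeq t x ht hx)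
    rw [← hσΓ ⟨1, h1mem⟩]
    exact eq_of_hasDerivAt_smul hk hδ ht (hσ0.trans hτ0.symm) hσ hτ
  refine ⟨δ, fun q ↦ Γ q ⟨1, h1mem⟩, hδ, ?_, fun x hx ↦ ?_, fun t ht x hx ↦ ?_⟩
  · exact (ContinuousMap.evalCLM ℝ (⟨1, h1mem⟩ : Icc (-1 : ℝ) 1)).contDiff.comp_contDiffOn hΓsmooth
  · obtain ⟨τ, hτ0, -, hτ⟩ := hflow x hx
    simpa [hτ0] using hτ 0 (by simpa using hδ.le)
  · obtain ⟨τ, -, hτd, hτ⟩ := hflow x hx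
    have htd : t / δ ∈ Icc (-1 : ℝ) 1 := by
      rw [mem_Icc, ← abs_le, abs_div, abs_of_pos hδ]
      exact (div_le_one hδ).2 (abs_lt.2 ht).le
    have h := (hτd _ htd).scomp t ((hasDerivAt_id t).div_const δ)
    rw [smul_smul, one_div, inv_mul_cancel₀ hδ.ne', one_smul] at h
    simp only
    rw [hτ t (abs_lt.2 ht).le]
    refine h.congr_of_eventuallyEq ?_
    filter_upwards [Ioo_mem_nhds ht.1 ht.2] with s hs
    exact hτ s (abs_lt.2 hs).le

/-- A smooth vector field on an open subset of a finite-dimensional space has a smooth local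
flow. -/
theorem exists_local_flow [FiniteDimensional ℝ E] {X : E → E} {W : Set E} (hW : IsOpen W)
    (hX : ContDiffOn ℝ ∞ X W) {x₀ : E} (hx₀ : x₀ ∈ W) :
    ∃ (δ : ℝ) (φ : ℝ × E → E), 0 < δ ∧ ContDiffOn ℝ ∞ φ (Ioo (-δ) δ ×ˢ Metric.ball x₀ δ) ∧
      (∀ x ∈ Metric.ball x₀ δ, φ (0, x) = x) ∧
      ∀ t ∈ Ioo (-δ) δ, ∀ x ∈ Metric.ball x₀ δ, φ (t, x) ∈ W ∧
        HasDerivAt (fun s ↦ φ (s, x)) (X (φ (t, x))) t := by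
  obtain ⟨r, hr, hrW⟩ := Metric.nhds_basis_closedBall.mem_iff.1 (hW.mem_nhds hx₀)
  -- The cut-off field is compactly supported, hence globally Lipschitz, and agrees with `X` on the
  -- ball of radius r/2. Times and initial points are restricted below so that the flow stays in
  -- that ball.
  let b : ContDiffBump x₀ := ⟨r / 2, r, by positivity, by linarith⟩
  have hsmooth : ContDiff ℝ ∞ (fun x ↦ b x • X x) := by
    rw [contDiff_iff_contDiffAt]
    intro x
    by_cases hx : x ∈ W
    · exact b.contDiff.contDiffAt.smul (hX.contDiffAt (hW.mem_nhds hx))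
    · have hx' : x ∉ tsupport b := fun h ↦ hx (hrW (by rwa [b.tsupport_eq] at h))
      refine contDiffAt_const (c := (0 : E)) |>.congr_of_eventuallyEq ?_
      filter_upwards [(isClosed_tsupport b).isOpen_compl.mem_nhds hx'] with y hy
      rw [image_eq_zero_of_notMem_tsupport hy, zero_smul]
  have hcomp : HasCompactSupport (fun x ↦ b x • X x) := b.hasCompactSupport.smul_right
  obtain ⟨k, hk⟩ := ContDiff.lipschitzWith_of_hasCompactSupport hcomp hsmooth (by simp)
  obtain ⟨δ, φ, hδ, hφ, hφ0, hφd⟩ := exists_local_flow_of_lipschitz hsmooth hk x₀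
  have hopen : IsOpen (Ioo (-δ) δ ×ˢ Metric.ball x₀ δ) := isOpen_Ioo.prod Metric.isOpen_ball
  have h0mem : ((0 : ℝ), x₀) ∈ Ioo (-δ) δ ×ˢ Metric.ball x₀ δ :=
    ⟨⟨by linarith, hδ⟩, Metric.mem_ball_self hδ⟩
  have hev : ∀ᶠ z in 𝓝 ((0 : ℝ), x₀), φ z ∈ Metric.ball x₀ (r / 2) := by
    refine (hφ.continuousOn.continuousAt (hopen.mem_nhds h0mem)).eventually ?_
    rw [hφ0 x₀ (Metric.mem_ball_self hδ)]
    exact Metric.ball_mem_nhds _ (by positivity)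
  obtain ⟨d, hd, hdball⟩ := Metric.eventually_nhds_iff_ball.1 hev
  have hmin : 0 < min d δ := lt_min hd hδ
  have hsub : Metric.ball x₀ (min d δ) ⊆ Metric.ball x₀ δ :=
    Metric.ball_subset_ball (min_le_right _ _)
  have hsub' : Ioo (-(min d δ)) (min d δ) ⊆ Ioo (-δ) δ :=
    Ioo_subset_Ioo (neg_le_neg (min_le_right _ _)) (min_le_right _ _)
  refine ⟨min d δ, φ, hmin, hφ.mono (prod_mono hsub' hsub), fun x hx ↦ hφ0 x (hsub hx),
    fun t ht x hx ↦ ?_⟩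
  have hball : φ (t, x) ∈ Metric.ball x₀ (r / 2) := by
    refine hdball (t, x) ?_
    rw [← ball_prod_same]
    refine ⟨?_, Metric.ball_subset_ball (min_le_left _ _) hx⟩
    rw [Metric.mem_ball, Real.dist_0_eq_abs]
    exact (abs_lt.2 ht).trans_le (min_le_left _ _)
  refine ⟨hrW (Metric.ball_subset_closedBall (Metric.ball_subset_ball (by linarith) hball)), ?_⟩
  have h := hφd t (hsub' ht) x (hsub hx)
  rwa [b.one_of_mem_closedBall (Metric.ball_subset_closedBall hball), one_smul] at h

end Flow

/-! ### Straightening a vector field dual to a closed one-form -/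

section Rectification

universe u

/-- The Poincaré lemma on a ball; the primitive is smooth because its derivative `α` is. -/
theorem exists_smooth_primitive {E : Type*} [NormedAddCommGroup E] [NormedSpace ℝ E]
    {W : Set E} (hW : IsOpen W) {α : E → E →L[ℝ] ℝ} (hα : ContDiffOn ℝ ∞ α W)
    (hclosed : ∀ x ∈ W, ∀ u v, fderiv ℝ α x u v = fderiv ℝ α x v u) {x₀ : E} (hx₀ : x₀ ∈ W) :
    ∃ (r : ℝ) (f : E → ℝ), 0 < r ∧ Metric.ball x₀ r ⊆ W ∧ f x₀ = 0 ∧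
      ContDiffOn ℝ ∞ f (Metric.ball x₀ r) ∧ ∀ x ∈ Metric.ball x₀ r, HasFDerivAt f (α x) x := by
  obtain ⟨r, hr, hrW⟩ := Metric.mem_nhds_iff.1 (hW.mem_nhds hx₀)
  obtain ⟨f, hf⟩ := (convex_ball x₀ r).exists_forall_hasFDerivAt_of_fderiv_symmetric
    Metric.isOpen_ball ((hα.mono hrW).differentiableOn (by simp))
    fun x hx u v ↦ hclosed x (hrW hx) u v
  have hf' : ∀ x ∈ Metric.ball x₀ r, HasFDerivAt (fun x ↦ f x - f x₀) (α x) x :=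
    fun x hx ↦ (hf x hx).sub_const _
  refine ⟨r, fun x ↦ f x - f x₀, hr, hrW, sub_self _, ?_, hf'⟩
  rw [contDiffOn_infty_iff_fderiv_of_isOpen Metric.isOpen_ball]
  exact ⟨fun x hx ↦ (hf' x hx).differentiableAt.differentiableWithinAt,
    (hα.mono hrW).congr fun x hx ↦ (hf' x hx).fderiv⟩

/-- From α X = 1 follows E = ℝX ⊕ ker α, and the dimension count identifies ker α with `E'`. This is
the linear model of the rectification. -/
theorem exists_adapted_equiv {E E' : Type*} [NormedAddCommGroup E] [NormedSpace ℝ E]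
    [FiniteDimensional ℝ E] [NormedAddCommGroup E'] [NormedSpace ℝ E'] [FiniteDimensional ℝ E']
    (hdim : Module.finrank ℝ E = Module.finrank ℝ E' + 1) {α : E →L[ℝ] ℝ} {X : E}
    (hαX : α X = 1) :
    ∃ (L : E' →L[ℝ] E) (T : (ℝ × E') ≃L[ℝ] E), (∀ w, α (L w) = 0) ∧
      ∀ a w, T (a, w) = a • X + L w := by
  have hker : Module.finrank ℝ E' = Module.finrank ℝ (LinearMap.ker (α : E →ₗ[ℝ] ℝ)) := by
    have h1 := LinearMap.finrank_range_add_finrank_ker (α : E →ₗ[ℝ] ℝ)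
    have h2 : LinearMap.range (α : E →ₗ[ℝ] ℝ) = ⊤ := by
      rw [LinearMap.range_eq_top]
      intro a
      exact ⟨a • X, by simp [hαX]⟩
    rw [h2, finrank_top, Module.finrank_self] at h1
    omega
  let L₀ := LinearEquiv.ofFinrankEq E' (LinearMap.ker (α : E →ₗ[ℝ] ℝ)) hker
  let L : E' →ₗ[ℝ] E := (LinearMap.ker (α : E →ₗ[ℝ] ℝ)).subtype ∘ₗ L₀.toLinearMap
  have hL : ∀ w, α (L w) = 0 := fun w ↦ (L₀ w).2
  let T₀ : (ℝ × E') →ₗ[ℝ] E := (LinearMap.toSpanSingleton ℝ E X).coprod L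
  have hT₀ : ∀ a w, T₀ (a, w) = a • X + L w := fun a w ↦ by simp [T₀]
  have hinj : Function.Injective T₀ := by
    rw [injective_iff_map_eq_zero]
    rintro ⟨a, w⟩ h
    rw [hT₀] at h
    have ha : a = 0 := by simpa [hL, hαX] using congrArg α h
    subst ha
    rw [zero_smul, zero_add] at h
    have : L₀ w = 0 := Subtype.ext h
    simp only [LinearEquiv.map_eq_zero_iff] at this
    simp [this]
  have hd : Module.finrank ℝ (ℝ × E') = Module.finrank ℝ E := by
    rw [Module.finrank_prod, Module.finrank_self, hdim, add_comm]
  exact ⟨L.toContinuousLinearMap,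
    (LinearEquiv.ofInjectiveOfFinrankEq T₀ hinj hd).toContinuousLinearEquiv, hL, hT₀⟩

/-- A smooth vector field `X` and a closed one-form `α` with `α X = 1` are simultaneously
straightened: there are local coordinates `(t, y)` with `X = ∂/∂t` and `α = dt`. -/
theorem exists_rectification {E : Type u} [NormedAddCommGroup E] [NormedSpace ℝ E]
    [FiniteDimensional ℝ E] {E' : Type*} [NormedAddCommGroup E'] [InnerProductSpace ℝ E']
    [FiniteDimensional ℝ E'] (hdim : Module.finrank ℝ E = Module.finrank ℝ E' + 1)
    {W : Set E} (hW : IsOpen W) {X : E → E} (hX : ContDiffOn ℝ ∞ X W)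
    {α : E → E →L[ℝ] ℝ} (hα : ContDiffOn ℝ ∞ α W)
    (hclosed : ∀ x ∈ W, ∀ u v, fderiv ℝ α x u v = fderiv ℝ α x v u)
    (hαX : ∀ x ∈ W, α x (X x) = 1) {x₀ : E} (hx₀ : x₀ ∈ W) :
    ∃ (δ : ℝ) (Ψ : OpenPartialHomeomorph (ℝ × E') E), 0 < δ ∧
      Ψ.source = Ioo (-δ) δ ×ˢ univ ∧ x₀ ∈ Ψ.target ∧ Ψ.target ⊆ W ∧
      ContDiffOn ℝ ∞ Ψ Ψ.source ∧ ContDiffOn ℝ ∞ Ψ.symm Ψ.target ∧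
      ∀ z ∈ Ψ.source, fderiv ℝ Ψ z (1, 0) = X (Ψ z) ∧
        ∀ v, α (Ψ z) (fderiv ℝ Ψ z (0, v)) = 0 := by
  obtain ⟨r, f, hr, hrW, hf0, hf, hfα⟩ := exists_smooth_primitive hW hα hclosed hx₀
  obtain ⟨ρ, φ, hρ, hφ, hφ0, hφX⟩ := exists_local_flow Metric.isOpen_ball (hX.mono hrW)
    (Metric.mem_ball_self hr)
  obtain ⟨L, T, hL, hT⟩ := exists_adapted_equiv hdim (hαX x₀ hx₀)
  -- Along the flow, df(X) = α(X) = 1, so `f` grows with unit speed.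
  have hflow : ∀ x ∈ Metric.ball x₀ ρ, ∀ t ∈ Ioo (-ρ) ρ, f (φ (t, x)) = f x + t := by
    intro x hx t ht
    have hd : ∀ s ∈ Ioo (-ρ) ρ, HasDerivAt (fun s ↦ f (φ (s, x)) - s) 0 s := fun s hs ↦ by
      obtain ⟨h1, h2⟩ := hφX s hs x hx
      have h3 := ((hfα _ h1).comp_hasDerivAt s h2).sub (hasDerivAt_id s)
      rw [hαX _ (hrW h1), sub_self] at h3
      exact h3
    have h0 : (0 : ℝ) ∈ Ioo (-ρ) ρ := ⟨by linarith, hρ⟩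
    have := isOpen_Ioo.is_const_of_deriv_eq_zero isPreconnected_Ioo
      (fun s hs ↦ (hd s hs).differentiableAt.differentiableWithinAt)
      (fun s hs ↦ (hd s hs).deriv) ht h0
    simp only [hφ0 x hx] at this
    linarith
  set m := min r ρ with hm
  have hm0 : 0 < m := lt_min hr hρ
  -- From the point x₀ + L w, flow for the time t − f(x₀ + L w): the endpoint then lies on the level
  -- set f = t.
  set g : ℝ × E' → ℝ × E := fun z ↦ (z.1 - f (x₀ + L z.2), x₀ + L z.2) with hg
  set S : Set (ℝ × E') := (fun z ↦ x₀ + L z.2) ⁻¹' Metric.ball x₀ m with hS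
  have hSopen : IsOpen S := Metric.isOpen_ball.preimage (by fun_prop)
  have haff : ContDiff ℝ ∞ (fun z : ℝ × E' ↦ x₀ + L z.2) :=
    contDiff_const.add (L.contDiff.comp contDiff_snd)
  have hgS : ContDiffOn ℝ ∞ g S :=
    (contDiff_fst.contDiffOn.sub (hf.comp haff.contDiffOn fun z hz ↦
      Metric.ball_subset_ball (min_le_left _ _) hz)).prodMk haff.contDiffOn
  have hbox : IsOpen (Ioo (-ρ) ρ ×ˢ Metric.ball x₀ ρ) := isOpen_Ioo.prod Metric.isOpen_ball
  set U := S ∩ g ⁻¹' (Ioo (-ρ) ρ ×ˢ Metric.ball x₀ ρ) with hU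
  have hUopen : IsOpen U := hgS.continuousOn.isOpen_inter_preimage hSopen hbox
  have hg0 : g 0 = (0, x₀) := by simp [hg, hf0]
  have hbox0 : ((0 : ℝ), x₀) ∈ Ioo (-ρ) ρ ×ˢ Metric.ball x₀ ρ :=
    ⟨⟨by linarith, hρ⟩, Metric.mem_ball_self hρ⟩
  have h0U : (0 : ℝ × E') ∈ U := ⟨by simp [hS, hm0], by rw [mem_preimage, hg0]; exact hbox0⟩
  have hφU : ContDiffOn ℝ ∞ (fun z ↦ φ (g z)) U :=
    hφ.comp (hgS.mono inter_subset_left) fun z hz ↦ hz.2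
  have hφd : HasFDerivAt φ (fderiv ℝ φ (0, x₀)) (0, x₀) :=
    ((hφ.contDiffAt (hbox.mem_nhds hbox0)).differentiableAt (by simp)).hasFDerivAt
  have hφd1 : fderiv ℝ φ (0, x₀) (1, 0) = X x₀ := by
    have h1 := (hφX 0 hbox0.1 x₀ hbox0.2).2
    rw [hφ0 x₀ hbox0.2] at h1
    exact (hφd.comp_hasDerivAt (0 : ℝ)
      ((hasDerivAt_id (0 : ℝ)).prodMk (hasDerivAt_const (0 : ℝ) x₀))).unique h1
  have hφd2 : ∀ v, fderiv ℝ φ (0, x₀) (0, v) = v := fun v ↦ by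
    have h1 : HasFDerivAt (fun x ↦ φ (0, x)) (ContinuousLinearMap.id ℝ E) x₀ :=
      (hasFDerivAt_id x₀).congr_of_eventuallyEq (by
        filter_upwards [Metric.ball_mem_nhds x₀ hρ] with x hx using hφ0 x hx)
    have h2 := hφd.comp x₀ ((hasFDerivAt_const (0 : ℝ) x₀).prodMk (hasFDerivAt_id x₀))
    exact DFunLike.congr_fun (h2.unique h1) v
  have hderiv : HasFDerivAt (fun z ↦ φ (g z)) (T : (ℝ × E') →L[ℝ] E) 0 := by
    have ha : HasFDerivAt (fun z : ℝ × E' ↦ x₀ + L z.2) (L.comp (ContinuousLinearMap.snd ℝ ℝ E'))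
        0 := (L.comp (ContinuousLinearMap.snd ℝ ℝ E')).hasFDerivAt.const_add x₀
    have hfa : HasFDerivAt f (α x₀) (x₀ + L (0 : ℝ × E').2) := by
      simpa using hfα x₀ (Metric.mem_ball_self hr)
    have hgd := (((ContinuousLinearMap.fst ℝ ℝ E').hasFDerivAt (x := 0)).sub
      (hfa.comp (0 : ℝ × E') ha)).prodMk ha
    have hφd' : HasFDerivAt φ (fderiv ℝ φ (0, x₀)) (g 0) := by rw [hg0]; exact hφd
    refine (hφd'.comp (0 : ℝ × E') hgd).congr_fderiv ?_
    refine ContinuousLinearMap.ext fun ⟨a, w⟩ ↦ ?_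
    have : ((a, L w) : ℝ × E) = a • ((1 : ℝ), (0 : E)) + (0, L w) := by simp
    change fderiv ℝ φ (0, x₀) (a - α x₀ (L w), L w) = T (a, w)
    rw [hL, sub_zero, this, map_add, map_smul, hφd1, hφd2, hT]
  obtain ⟨e, he, h0e, heU, hesymm⟩ := exists_openPartialHomeomorph_of_contDiffOn hUopen hφU h0U T
    hderiv
  obtain ⟨δ, hδ, hδe⟩ := Metric.mem_nhds_iff.1 (e.open_source.mem_nhds h0e)
  have hball : ∀ t ∈ Ioo (-δ) δ, ∀ y ∈ Metric.ball (0 : E') δ, (t, y) ∈ e.source :=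
    fun t ht y hy ↦ hδe (by
      rw [← Prod.mk_zero_zero, ← ball_prod_same]
      exact ⟨by rw [Metric.mem_ball, Real.dist_0_eq_abs]; exact abs_lt.2 ht, hy⟩)
  -- Compress all of `E'` diffeomorphically onto a ball, so that the fibre becomes the whole vector
  -- space.
  set b := OpenPartialHomeomorph.univBall (0 : E') δ with hb
  have hbsrc : b.source = univ := OpenPartialHomeomorph.univBall_source _ _
  have hbtgt : b.target = Metric.ball 0 δ := OpenPartialHomeomorph.univBall_target _ hδ
  have hbmem : ∀ y, b y ∈ Metric.ball (0 : E') δ := fun y ↦ by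
    rw [← hbtgt]; exact b.map_source (by rw [hbsrc]; trivial)
  set c := (OpenPartialHomeomorph.ofSet (Ioo (-δ) δ) isOpen_Ioo).prod b with hc
  have hcsrc : c.source = Ioo (-δ) δ ×ˢ univ := by simp [hc, hbsrc]
  have hctgt : c.target = Ioo (-δ) δ ×ˢ Metric.ball 0 δ := by simp [hc, hbtgt]
  have hcsmooth : ContDiff ℝ ∞ c :=
    contDiff_fst.prodMk (OpenPartialHomeomorph.contDiff_univBall.comp contDiff_snd)
  have hcsymm : ContDiffOn ℝ ∞ c.symm c.target := by
    rw [hctgt]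
    exact contDiff_fst.contDiffOn.prodMk
      (OpenPartialHomeomorph.contDiffOn_univBall_symm.comp contDiff_snd.contDiffOn fun z hz ↦ hz.2)
  have hsrc : (c.trans e).source = Ioo (-δ) δ ×ˢ univ := by
    rw [OpenPartialHomeomorph.trans_source, hcsrc]
    refine inter_eq_left.2 fun z hz ↦ hball _ hz.1 _ (hbmem z.2)
  have hsmooth : ContDiffOn ℝ ∞ (c.trans e) (c.trans e).source := by
    have : ContDiffOn ℝ ∞ e e.source := by rw [he]; exact hφU.mono heU
    exact this.comp hcsmooth.contDiffOn fun z hz ↦ hz.2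
  have hmemU : ∀ z ∈ (c.trans e).source, c z ∈ U := fun z hz ↦ heU hz.2
  have hval : ∀ z, (c.trans e) z = φ (z.1 - f (x₀ + L (b z.2)), x₀ + L (b z.2)) := fun z ↦ by
    change e (c z) = _
    rw [he]; rfl
  have hfval : ∀ z ∈ (c.trans e).source, f ((c.trans e) z) = z.1 := fun z hz ↦ by
    have h := hflow (x₀ + L (b z.2)) (hmemU z hz).2.2 (z.1 - f (x₀ + L (b z.2))) (hmemU z hz).2.1
    rw [hval, h]
    ring
  have hmemr : ∀ z ∈ (c.trans e).source, (c.trans e) z ∈ Metric.ball x₀ r := fun z hz ↦ by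
    rw [hval]; exact (hφX _ (hmemU z hz).2.1 _ (hmemU z hz).2.2).1
  refine ⟨δ, c.trans e, hδ, hsrc, ?_, ?_, hsmooth, ?_, fun z hz ↦ ?_⟩
  · have h0 : (0 : ℝ × E') ∈ (c.trans e).source := by
      rw [hsrc]; exact ⟨⟨by simpa using hδ, hδ⟩, trivial⟩
    have := (c.trans e).map_source h0
    rw [hval, hb] at this
    simpa [hf0, hφ0 x₀ (Metric.mem_ball_self hρ)] using this
  · intro x hx
    have := hmemr _ ((c.trans e).map_target hx)
    rw [(c.trans e).right_inv hx] at this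
    exact hrW this
  · exact hcsymm.comp (hesymm.mono inter_subset_left) fun x hx ↦ hx.2
  · have hd : HasFDerivAt (c.trans e) (fderiv ℝ (c.trans e) z) z :=
      ((hsmooth.contDiffAt ((c.trans e).open_source.mem_nhds hz)).differentiableAt
        (by simp)).hasFDerivAt
    constructor
    · have h1 := hd.comp_hasDerivAt z.1
        ((hasDerivAt_id z.1).prodMk (hasDerivAt_const z.1 z.2))
      have h2 := (hφX _ (hmemU z hz).2.1 _ (hmemU z hz).2.2).2
      have h3 := h2.scomp z.1 ((hasDerivAt_id z.1).sub_const (f (x₀ + L (b z.2))))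
      rw [one_smul] at h3
      rw [hval]
      exact h1.unique (h3.congr_of_eventuallyEq (Eventually.of_forall fun s ↦ hval (s, z.2)))
    · intro v
      have h1 := (hfα _ (hmemr z hz)).comp z hd
      -- In the new coordinates `f` is the first coordinate, so α = df vanishes on the fibre
      -- directions.
      have h2 : HasFDerivAt (f ∘ (c.trans e)) (ContinuousLinearMap.fst ℝ ℝ E') z :=
        (ContinuousLinearMap.fst ℝ ℝ E').hasFDerivAt.congr_of_eventuallyEq (by
          filter_upwards [(c.trans e).open_source.mem_nhds hz] with y hy using hfval y hy)
      exact DFunLike.congr_fun (h1.unique h2) (0, v)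

end Rectification

/-! ### Symmetric operators with two eigenvalues -/

section TwoEigenvalues

variable {V : Type*} [NormedAddCommGroup V] [InnerProductSpace ℝ V] [FiniteDimensional ℝ V]
  {B : V →ₗ[ℝ] V} {a b : ℝ}

/-- The operator (B − a)(B − b) kills every eigenspace, and the eigenspaces of a symmetric operator
span. -/
theorem quadratic_of_two_eigenvalues (hB : B.IsSymmetric)
    (h : ∀ r, Module.End.HasEigenvalue B r → r = a ∨ r = b) (v : V) :
    B (B v) = (a + b) • B v - (a * b) • v := by
  set Q : V →ₗ[ℝ] V := B ∘ₗ B - (a + b) • B + (a * b) • LinearMap.id with hQ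
  have hker : (⨆ r, Module.End.eigenspace B r) ≤ LinearMap.ker Q := by
    refine iSup_le fun r w hw ↦ ?_
    by_cases hr : Module.End.HasEigenvalue B r
    · rw [Module.End.mem_eigenspace_iff] at hw
      rw [LinearMap.mem_ker]
      simp only [hQ, LinearMap.add_apply, LinearMap.sub_apply, LinearMap.comp_apply,
        LinearMap.smul_apply, LinearMap.id_apply, hw, map_smul, smul_smul, ← sub_smul, ← add_smul]
      rcases h r hr with rfl | rfl <;> ring_nf <;> simp
    · rw [Module.End.hasEigenvalue_iff, not_not] at hr
      rw [hr, Submodule.mem_bot] at hw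
      rw [hw]
      exact Submodule.zero_mem _
  have htop : (⨆ r, Module.End.eigenspace B r) = ⊤ := by
    rw [← Submodule.orthogonal_eq_bot_iff]
    exact hB.orthogonalComplement_iSup_eigenspaces_eq_bot
  have hv : v ∈ LinearMap.ker Q := hker (htop ▸ Submodule.mem_top)
  rw [LinearMap.mem_ker] at hv
  simp only [hQ, LinearMap.add_apply, LinearMap.sub_apply, LinearMap.comp_apply,
        LinearMap.smul_apply, LinearMap.id_apply] at hv
  rw [← sub_eq_zero, ← hv]
  abel

theorem inner_eq_zero_of_mem_eigenspace (hB : B.IsSymmetric) (hab : a ≠ b) {v w : V}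
    (hv : v ∈ Module.End.eigenspace B a) (hw : w ∈ Module.End.eigenspace B b) :
    inner ℝ v w = 0 := by
  rw [Module.End.mem_eigenspace_iff] at hv hw
  have h := hB v w
  rw [hv, hw, real_inner_smul_left, real_inner_smul_right] at h
  have : (a - b) * inner ℝ v w = 0 := by linarith
  exact (mul_eq_zero.1 this).resolve_left (sub_ne_zero.2 hab)

/-- This is (B − a)(B − b) = 0. Up to scale, B − b projects onto the a-eigenspace and depends
smoothly on its coefficients, so it turns arbitrary smooth fields into fields of eigenvectors. -/
theorem sub_smul_mem_eigenspace (hq : ∀ v, B (B v) = (a + b) • B v - (a * b) • v) (v : V) :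
    B v - b • v ∈ Module.End.eigenspace B a := by
  rw [Module.End.mem_eigenspace_iff, map_sub, map_smul, hq]
  module

/-- The vector u = (B − b)v lies in the a-eigenspace, and ⟨u, u⟩ = (a − b)⟨v, u⟩ = 0. -/
theorem mem_eigenspace_of_orthogonal (hB : B.IsSymmetric)
    (hq : ∀ v, B (B v) = (a + b) • B v - (a * b) • v) {v : V}
    (hv : ∀ u ∈ Module.End.eigenspace B a, inner ℝ v u = 0) :
    v ∈ Module.End.eigenspace B b := by
  have hu := sub_smul_mem_eigenspace hq v
  have h0 : inner ℝ (B v - b • v) (B v - b • v) = (0 : ℝ) := by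
    have h2 : inner ℝ (B v) (B v - b • v) = inner ℝ v (B (B v - b • v)) := hB _ _
    rw [inner_sub_left, h2, Module.End.mem_eigenspace_iff.1 hu, real_inner_smul_right,
      real_inner_smul_left, hv _ hu]
    ring
  rw [inner_self_eq_zero, sub_eq_zero] at h0
  exact Module.End.mem_eigenspace_iff.2 h0

theorem finrank_eigenspace_add (hB : B.IsSymmetric) (hab : a ≠ b)
    (hq : ∀ v, B (B v) = (a + b) • B v - (a * b) • v) :
    Module.finrank ℝ (Module.End.eigenspace B a) + Module.finrank ℝ (Module.End.eigenspace B b) =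
      Module.finrank ℝ V := by
  have : Module.End.eigenspace B b = (Module.End.eigenspace B a)ᗮ := by
    ext v
    refine ⟨fun hv u hu ↦ inner_eq_zero_of_mem_eigenspace hB hab hu hv, fun hv ↦
      mem_eigenspace_of_orthogonal hB hq fun u hu ↦ ?_⟩
    rw [real_inner_comm]
    exact hv u hu
  rw [this]
  exact Submodule.finrank_add_finrank_orthogonal _

/-- The operator (a − b)⁻¹(B − b) is a projection onto a line and so has trace 1. -/
theorem trace_of_two_eigenvalues (hab : a ≠ b)
    (hq : ∀ v, B (B v) = (a + b) • B v - (a * b) • v)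
    (hdim : Module.finrank ℝ (Module.End.eigenspace B a) = 1) :
    LinearMap.trace ℝ V B = a + ((Module.finrank ℝ V : ℝ) - 1) * b := by
  have hab' : a - b ≠ 0 := sub_ne_zero.2 hab
  set P : V →ₗ[ℝ] V := (a - b)⁻¹ • (B - b • LinearMap.id) with hP
  have hproj : LinearMap.IsProj (Module.End.eigenspace B a) P := by
    refine ⟨fun v ↦ Submodule.smul_mem _ _ (sub_smul_mem_eigenspace hq v), fun v hv ↦ ?_⟩
    rw [Module.End.mem_eigenspace_iff] at hv
    simp only [hP, LinearMap.smul_apply, LinearMap.sub_apply, LinearMap.id_apply, hv, ← sub_smul,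
      smul_smul, inv_mul_cancel₀ hab', one_smul]
  have htr := hproj.trace
  have hBP : B = (a - b) • P + b • LinearMap.id := by
    rw [hP, smul_smul, mul_inv_cancel₀ hab', one_smul, sub_add_cancel]
  clear_value P
  rw [hBP, map_add, map_smul, map_smul, htr, hdim, LinearMap.trace_id]
  simp only [Nat.cast_one, smul_eq_mul]
  ring

/-- The difference of the two eigenvalues, one of which is simple, is a rational function of the
traces of the powers of the operator. -/
theorem eigenvalue_sub_eq {d : ℝ} (hd : Module.finrank ℝ V = d) (hd3 : 3 ≤ d) (hab : a ≠ b)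
    (hq : ∀ v, B (B v) = (a + b) • B v - (a * b) • v)
    (hdim : Module.finrank ℝ (Module.End.eigenspace B a) = 1) :
    d ^ 2 * LinearMap.trace ℝ V (B ∘ₗ B) - d * LinearMap.trace ℝ V B ^ 2 ≠ 0 ∧
    a - b = (d ^ 3 * LinearMap.trace ℝ V (B ∘ₗ B ∘ₗ B)
        - 3 * d ^ 2 * LinearMap.trace ℝ V B * LinearMap.trace ℝ V (B ∘ₗ B)
        + 2 * d * LinearMap.trace ℝ V B ^ 3) /
      ((d - 2) * (d ^ 2 * LinearMap.trace ℝ V (B ∘ₗ B) - d * LinearMap.trace ℝ V B ^ 2)) := by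
  have h1 := trace_of_two_eigenvalues hab hq hdim
  have hB2 : B ∘ₗ B = (a + b) • B - (a * b) • LinearMap.id := LinearMap.ext hq
  have h2 : LinearMap.trace ℝ V (B ∘ₗ B) = a ^ 2 + (d - 1) * b ^ 2 := by
    rw [hB2, map_sub, map_smul, map_smul, h1, LinearMap.trace_id, hd, smul_eq_mul, smul_eq_mul]
    ring
  have h3 : LinearMap.trace ℝ V (B ∘ₗ B ∘ₗ B) = a ^ 3 + (d - 1) * b ^ 3 := by
    have : B ∘ₗ B ∘ₗ B = (a + b) • (B ∘ₗ B) - (a * b) • B := by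
      rw [hB2]; ext v; simp [hq]
    rw [this, map_sub, map_smul, map_smul, h1, h2, hd, smul_eq_mul, smul_eq_mul]
    ring
  rw [hd] at h1
  have hab' : a - b ≠ 0 := sub_ne_zero.2 hab
  -- Up to powers of d, denominator and numerator are the second and third central moments of the
  -- spectrum. They equal d(d − 1)(a − b)² and d(d − 1)(d − 2)(a − b)³, so the quotient determines a
  -- − b only if d ≠ 2.
  have hden : d ^ 2 * LinearMap.trace ℝ V (B ∘ₗ B) - d * LinearMap.trace ℝ V B ^ 2 =
      (a - b) ^ 2 * (d * (d - 1)) := by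
    rw [h1, h2]; ring
  have hd0 : d ≠ 0 := by linarith
  have hd1 : d - 1 ≠ 0 := by linarith
  have hd2 : d - 2 ≠ 0 := by linarith
  refine ⟨by rw [hden]; positivity, ?_⟩
  rw [hden, eq_div_iff (by positivity), h1, h2, h3]
  ring

end TwoEigenvalues

/-! ### Smoothness of the eigenfunctions and of the unit eigenfield -/

section Smoothness

variable {E : Type*} [NormedAddCommGroup E] [NormedSpace ℝ E] [FiniteDimensional ℝ E]
  {H : Type*} [TopologicalSpace H] {I : ModelWithCorners ℝ E H}
  {M : Type*} [TopologicalSpace M] [ChartedSpace H M] [IsManifold I ∞ M]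
  [RiemannianBundle (fun x : M ↦ TangentSpace I x)]

/-- Smoothness at `x` of a `(1,1)` tensor field. -/
abbrev TensorSmoothAt (A : Π x : M, TangentSpace I x →L[ℝ] TangentSpace I x) (x : M) : Prop :=
  ContMDiffAt I (I.prod 𝓘(ℝ, E →L[ℝ] E)) ∞
    (fun x ↦ TotalSpace.mk' (E →L[ℝ] E)
      (E := fun x : M ↦ TangentSpace I x →L[ℝ] TangentSpace I x) x (A x)) x

/-- A trivialization turns the tensor into a smooth family of operators on one fixed space,
conjugate to it pointwise. Traces are conjugation invariant and can be computed there. -/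
theorem exists_smooth_conj {A : Π x : M, TangentSpace I x →L[ℝ] TangentSpace I x} {x : M}
    (hA : TensorSmoothAt A x) :
    ∃ B : M → E →L[ℝ] E, ContMDiffAt I 𝓘(ℝ, E →L[ℝ] E) ∞ B x ∧
      ∀ᶠ y in 𝓝 x, ∃ e : TangentSpace I y ≃ₗ[ℝ] E, (B y : E →ₗ[ℝ] E) =
        e.conj (A y : TangentSpace I y →ₗ[ℝ] TangentSpace I y) := by
  rw [TensorSmoothAt, contMDiffAt_hom_bundle] at hA
  refine ⟨_, hA.2, ?_⟩
  have hbase := (trivializationAt E (TangentSpace I) x).open_baseSet.mem_nhds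
    (FiberBundle.mem_baseSet_trivializationAt' x)
  filter_upwards [hbase] with y hy
  refine ⟨((trivializationAt E (TangentSpace I) x).continuousLinearEquivAt ℝ y hy).toLinearEquiv, ?_⟩
  rw [ContinuousLinearMap.inCoordinates_eq hy hy]
  ext v
  rfl

/-- The trace, as a continuous linear functional. -/
def traceCLM (E : Type*) [NormedAddCommGroup E] [NormedSpace ℝ E] [FiniteDimensional ℝ E] :
    (E →L[ℝ] E) →L[ℝ] ℝ :=
  LinearMap.toContinuousLinearMap ((LinearMap.trace ℝ E) ∘ₗ ContinuousLinearMap.coeLM ℝ)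

theorem traceCLM_apply (B : E →L[ℝ] E) : traceCLM E B = LinearMap.trace ℝ E (B : E →ₗ[ℝ] E) := rfl

theorem contMDiffAt_trace_powers {A : Π x : M, TangentSpace I x →L[ℝ] TangentSpace I x} {x : M}
    (hA : TensorSmoothAt A x) :
    ContMDiffAt I 𝓘(ℝ) ∞ (trace A) x ∧
    ContMDiffAt I 𝓘(ℝ) ∞ (fun y ↦ LinearMap.trace ℝ (TangentSpace I y)
      ((A y : TangentSpace I y →ₗ[ℝ] TangentSpace I y) ∘ₗ
        (A y : TangentSpace I y →ₗ[ℝ] TangentSpace I y))) x ∧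
    ContMDiffAt I 𝓘(ℝ) ∞ (fun y ↦ LinearMap.trace ℝ (TangentSpace I y)
      ((A y : TangentSpace I y →ₗ[ℝ] TangentSpace I y) ∘ₗ
        (A y : TangentSpace I y →ₗ[ℝ] TangentSpace I y) ∘ₗ
        (A y : TangentSpace I y →ₗ[ℝ] TangentSpace I y))) x := by
  obtain ⟨B, hB, hBA⟩ := exists_smooth_conj hA
  have h2 := hB.clm_comp hB
  have h3 := hB.clm_comp h2
  refine ⟨((traceCLM E).contMDiff.contMDiffAt.comp x hB).congr_of_eventuallyEq ?_,
    ((traceCLM E).contMDiff.contMDiffAt.comp x h2).congr_of_eventuallyEq ?_,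
    ((traceCLM E).contMDiff.contMDiffAt.comp x h3).congr_of_eventuallyEq ?_⟩
  all_goals
    filter_upwards [hBA] with y ⟨e, he⟩
    simp only [Function.comp_apply, traceCLM_apply, ContinuousLinearMap.toLinearMap_comp, he]
  · rw [LinearMap.trace_conj']; rfl
  · rw [← LinearEquiv.conj_comp, LinearMap.trace_conj']
  · rw [← LinearEquiv.conj_comp, ← LinearEquiv.conj_comp, LinearMap.trace_conj']

end Smoothness

/-! ### Eigenfunctions and eigenfields when one of two eigenvalues is simple -/

section Eigenfields

variable {E : Type*} [NormedAddCommGroup E] [NormedSpace ℝ E] [FiniteDimensional ℝ E]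
  {H : Type*} [TopologicalSpace H] {I : ModelWithCorners ℝ E H}
  {M : Type*} [TopologicalSpace M] [ChartedSpace H M] [IsManifold I ∞ M]
  [RiemannianBundle (fun x : M ↦ TangentSpace I x)]
  [IsContMDiffRiemannianBundle I ∞ E (fun x : M ↦ TangentSpace I x)]

/-- On the open set `U`, the Codazzi tensor `A` has exactly two eigenfunctions `μ` and `lam`, where
`μ` is simple. -/
structure IsSimpleTwoEigen (A : Π x : M, TangentSpace I x →L[ℝ] TangentSpace I x)
    (μ lam : M → ℝ) (U : Set M) : Prop where
  isCodazzi : IsCodazzi A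
  isOpen : IsOpen U
  eigen : HasTwoEigenfunctionsOn A μ lam U
  simple : ∀ x ∈ U, Module.finrank ℝ (eigenDist A μ x) = 1
  three_le : 3 ≤ Module.finrank ℝ E

namespace IsSimpleTwoEigen

variable {A : Π x : M, TangentSpace I x →L[ℝ] TangentSpace I x} {μ lam : M → ℝ} {U : Set M}

theorem isSymmetric (h : IsSimpleTwoEigen A μ lam U) (x : M) :
    (A x : TangentSpace I x →ₗ[ℝ] TangentSpace I x).IsSymmetric :=
  fun v w ↦ h.isCodazzi.selfAdjoint x v w

theorem quadratic (h : IsSimpleTwoEigen A μ lam U) {x : M} (hx : x ∈ U) (v : TangentSpace I x) :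
    A x (A x v) = (μ x + lam x) • A x v - (μ x * lam x) • v :=
  quadratic_of_two_eigenvalues (h.isSymmetric x) (fun r hr ↦ ((h.eigen x hx).2 r).1 hr) v

theorem quadratic' (h : IsSimpleTwoEigen A μ lam U) {x : M} (hx : x ∈ U) (v : TangentSpace I x) :
    A x (A x v) = (lam x + μ x) • A x v - (lam x * μ x) • v := by
  rw [h.quadratic hx, add_comm (μ x), mul_comm (μ x)]

theorem sub_ne_zero (h : IsSimpleTwoEigen A μ lam U) {x : M} (hx : x ∈ U) : μ x - lam x ≠ 0 :=
  _root_.sub_ne_zero.2 (h.eigen x hx).1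

theorem mem_mu {x : M} {v : TangentSpace I x} : v ∈ eigenDist A μ x ↔ A x v = μ x • v :=
  Module.End.mem_eigenspace_iff

theorem inner_eq_zero (h : IsSimpleTwoEigen A μ lam U) {x : M} (hx : x ∈ U)
    {v w : TangentSpace I x} (hv : v ∈ eigenDist A μ x) (hw : w ∈ eigenDist A lam x) :
    inner ℝ v w = 0 :=
  inner_eq_zero_of_mem_eigenspace (h.isSymmetric x) (h.eigen x hx).1 hv hw

theorem mem_lam_of_orthogonal (h : IsSimpleTwoEigen A μ lam U) {x : M} (hx : x ∈ U)
    {v : TangentSpace I x} (hv : ∀ u ∈ eigenDist A μ x, inner ℝ v u = 0) :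
    v ∈ eigenDist A lam x :=
  mem_eigenspace_of_orthogonal (h.isSymmetric x) (fun v ↦ h.quadratic hx v) hv

theorem finrank_lam (h : IsSimpleTwoEigen A μ lam U) {x : M} (hx : x ∈ U) :
    1 + Module.finrank ℝ (eigenDist A lam x) = Module.finrank ℝ E := by
  have := finrank_eigenspace_add (h.isSymmetric x) (h.eigen x hx).1 (fun v ↦ h.quadratic hx v)
  rw [← h.simple x hx]
  exact this

theorem trace_eq (h : IsSimpleTwoEigen A μ lam U) {x : M} (hx : x ∈ U) :
    trace A x = μ x + ((Module.finrank ℝ E : ℝ) - 1) * lam x :=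
  trace_of_two_eigenvalues (h.eigen x hx).1 (fun v ↦ h.quadratic hx v) (h.simple x hx)

/-- The difference is a rational function of the smooth traces of A, A², A³ with nonvanishing
denominator. Together with the trace itself it yields smoothness of both eigenfunctions. -/
theorem contMDiffAt_sub (h : IsSimpleTwoEigen A μ lam U) {x : M} (hx : x ∈ U) :
    ContMDiffAt I 𝓘(ℝ) ∞ (fun y ↦ μ y - lam y) x := by
  obtain ⟨h1, h2, h3⟩ := contMDiffAt_trace_powers (h.isCodazzi.smooth.contMDiffAt (x := x))
  have hd3 : (3 : ℝ) ≤ Module.finrank ℝ E := by exact_mod_cast h.three_le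
  have key := fun y (hy : y ∈ U) ↦ eigenvalue_sub_eq (V := TangentSpace I y)
    (d := Module.finrank ℝ E) rfl hd3 (h.eigen y hy).1 (fun v ↦ h.quadratic hy v) (h.simple y hy)
  have hnum : ContMDiffAt I 𝓘(ℝ, ℝ × ℝ × ℝ) ∞ (fun y ↦ (trace A y,
      LinearMap.trace ℝ (TangentSpace I y) ((A y : TangentSpace I y →ₗ[ℝ] TangentSpace I y) ∘ₗ
        (A y : TangentSpace I y →ₗ[ℝ] TangentSpace I y)),
      LinearMap.trace ℝ (TangentSpace I y) ((A y : TangentSpace I y →ₗ[ℝ] TangentSpace I y) ∘ₗ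
        (A y : TangentSpace I y →ₗ[ℝ] TangentSpace I y) ∘ₗ
        (A y : TangentSpace I y →ₗ[ℝ] TangentSpace I y)))) x :=
    h1.prodMk_space (h2.prodMk_space h3)
  have hrat : ContDiffAt ℝ ∞ (fun s : ℝ × ℝ × ℝ ↦
      ((Module.finrank ℝ E : ℝ) ^ 3 * s.2.2 - 3 * (Module.finrank ℝ E : ℝ) ^ 2 * s.1 * s.2.1
        + 2 * (Module.finrank ℝ E : ℝ) * s.1 ^ 3) /
      (((Module.finrank ℝ E : ℝ) - 2) *
        ((Module.finrank ℝ E : ℝ) ^ 2 * s.2.1 - (Module.finrank ℝ E : ℝ) * s.1 ^ 2)))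
      (trace A x,
      LinearMap.trace ℝ (TangentSpace I x) ((A x : TangentSpace I x →ₗ[ℝ] TangentSpace I x) ∘ₗ
        (A x : TangentSpace I x →ₗ[ℝ] TangentSpace I x)),
      LinearMap.trace ℝ (TangentSpace I x) ((A x : TangentSpace I x →ₗ[ℝ] TangentSpace I x) ∘ₗ
        (A x : TangentSpace I x →ₗ[ℝ] TangentSpace I x) ∘ₗ
        (A x : TangentSpace I x →ₗ[ℝ] TangentSpace I x))) := by
    refine ContDiffAt.div (by fun_prop) (by fun_prop) ?_
    exact mul_ne_zero (by linarith) (key x hx).1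
  refine (hrat.contMDiffAt.comp x hnum).congr_of_eventuallyEq ?_
  filter_upwards [h.isOpen.mem_nhds hx] with y hy using (key y hy).2

theorem contMDiffAt_lam (h : IsSimpleTwoEigen A μ lam U) {x : M} (hx : x ∈ U) :
    ContMDiffAt I 𝓘(ℝ) ∞ lam x := by
  have h1 := (contMDiffAt_trace_powers (h.isCodazzi.smooth.contMDiffAt (x := x))).1
  have h2 : ContMDiffAt I 𝓘(ℝ) ∞
      (fun y ↦ (Module.finrank ℝ E : ℝ)⁻¹ * (trace A y - (μ y - lam y))) x :=
    contMDiffAt_const.mul (h1.sub (h.contMDiffAt_sub hx))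
  refine h2.congr_of_eventuallyEq ?_
  filter_upwards [h.isOpen.mem_nhds hx] with y hy
  have hd3 : (3 : ℝ) ≤ Module.finrank ℝ E := by exact_mod_cast h.three_le
  rw [h.trace_eq hy]
  field_simp
  ring

theorem contMDiffAt_mu (h : IsSimpleTwoEigen A μ lam U) {x : M} (hx : x ∈ U) :
    ContMDiffAt I 𝓘(ℝ) ∞ μ x := by
  have h2 : ContMDiffAt I 𝓘(ℝ) ∞ (fun y ↦ (μ y - lam y) + lam y) x :=
    (h.contMDiffAt_sub hx).add (h.contMDiffAt_lam hx)
  simpa using h2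

theorem mdifferentiableAt_lam (h : IsSimpleTwoEigen A μ lam U) {x : M} (hx : x ∈ U) :
    MDiffAt lam x := (h.contMDiffAt_lam hx).mdifferentiableAt (by simp)

theorem mdifferentiableAt_mu (h : IsSimpleTwoEigen A μ lam U) {x : M} (hx : x ∈ U) :
    MDiffAt μ x := (h.contMDiffAt_mu hx).mdifferentiableAt (by simp)

theorem contMDiffAt_apply_sub_smul (h : IsSimpleTwoEigen A μ lam U) {x : M}
    {Y : Π x : M, TangentSpace I x} (hY : ContMDiffAt I I.tangent ∞ (T% Y) x) {f : M → ℝ}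
    (hf : ContMDiffAt I 𝓘(ℝ) ∞ f x) :
    ContMDiffAt I I.tangent ∞ (T% (fun y ↦ A y (Y y) - f y • Y y)) x :=
  (h.isCodazzi.smooth.contMDiffAt.clm_bundle_apply hY).sub_section (hf.smul_section hY)

/-- Every eigenvector for `lam` extends to a smooth field of eigenvectors for `lam`. -/
theorem exists_extension_lam (h : IsSimpleTwoEigen A μ lam U) {x : M} (hx : x ∈ U)
    {v : TangentSpace I x} (hv : v ∈ eigenDist A lam x) :
    ∃ Y : Π x : M, TangentSpace I x, ContMDiffAt I I.tangent ∞ (T% Y) x ∧ Y x = v ∧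
      ∀ y ∈ U, Y y ∈ eigenDist A lam y := by
  have hv' : v = FiberBundle.extend E v x := by simp
  have hext : ContMDiffAt I I.tangent ∞ (T% (FiberBundle.extend E v)) x :=
    FiberBundle.contMDiffAt_extend I E v
  have hsub := h.contMDiffAt_apply_sub_smul hext (h.contMDiffAt_mu hx)
  -- A multiple of the projection A − μ onto V_λ; the scalar is frozen at `x`, where it makes the
  -- value equal to `v`.
  refine ⟨(lam x - μ x)⁻¹ • fun y ↦ A y (FiberBundle.extend E v y)
    - μ y • FiberBundle.extend E v y, hsub.const_smul_section, ?_, fun y hy ↦ ?_⟩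
  · rw [Pi.smul_apply, ← hv', (mem_mu (μ := lam)).1 hv, ← sub_smul, smul_smul, inv_mul_cancel₀,
      one_smul]
    rw [← neg_sub, neg_ne_zero]
    exact h.sub_ne_zero hx
  · exact Submodule.smul_mem _ _ (sub_smul_mem_eigenspace
      (B := (A y : TangentSpace I y →ₗ[ℝ] TangentSpace I y)) (fun v ↦ h.quadratic' hy v) _)

/-- Near every point of `U` there is a smooth unit field of eigenvectors for `μ`. -/
theorem exists_unit_field (h : IsSimpleTwoEigen A μ lam U) {x : M} (hx : x ∈ U) :
    ∃ (T : Π x : M, TangentSpace I x) (W : Set M), IsOpen W ∧ x ∈ W ∧ W ⊆ U ∧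
      ContMDiffOn I I.tangent ∞ (T% T) W ∧ ∀ y ∈ W, T y ∈ eigenDist A μ y ∧ ‖T y‖ = 1 := by
  obtain ⟨⟨v, hv⟩, hv0⟩ := Module.finrank_pos_iff_exists_ne_zero.1
    (by rw [h.simple x hx]; exact one_pos : 0 < Module.finrank ℝ (eigenDist A μ x))
  have hv0' : v ≠ 0 := fun h0 ↦ hv0 (Subtype.ext h0)
  obtain ⟨s, hs, hext⟩ := FiberBundle.exists_contMDiffOn_extend (k := ∞) I E v
  obtain ⟨s', hs's, hs'open, hxs'⟩ := mem_nhds_iff.1 hs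
  set Z : Π x : M, TangentSpace I x := FiberBundle.extend E v with hZ
  set Y : Π x : M, TangentSpace I x := fun y ↦ A y (Z y) - lam y • Z y with hYdef
  have hYsmooth : ContMDiffOn I I.tangent ∞ (T% Y) (s' ∩ U) := fun y hy ↦
    (h.contMDiffAt_apply_sub_smul (hext.contMDiffAt (mem_of_superset (hs'open.mem_nhds hy.1) hs's))
      (h.contMDiffAt_lam hy.2)).contMDiffWithinAt
  have hYmem : ∀ y ∈ U, Y y ∈ eigenDist A μ y := fun y hy ↦ sub_smul_mem_eigenspace
      (B := (A y : TangentSpace I y →ₗ[ℝ] TangentSpace I y)) (fun v ↦ h.quadratic hy v) _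
  have hnorm : ContMDiffOn I 𝓘(ℝ) ∞ (fun y ↦ inner ℝ (Y y) (Y y)) (s' ∩ U) :=
    ContMDiffOn.inner_bundle (E := fun x : M ↦ TangentSpace I x) (b := fun y : M ↦ y) hYsmooth hYsmooth
  have hopen : IsOpen (s' ∩ U) := hs'open.inter h.isOpen
  have hYx : Y x ≠ 0 := by
    have hv' : Z x = v := by simp [hZ]
    simp only [hYdef, hv', mem_mu.1 hv, ← sub_smul]
    exact smul_ne_zero (h.sub_ne_zero hx) hv0'
  set W := (s' ∩ U) ∩ (fun y ↦ (inner ℝ (Y y) (Y y) : ℝ)) ⁻¹' {0}ᶜ with hW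
  have hWopen : IsOpen W := hnorm.continuousOn.isOpen_inter_preimage hopen isOpen_compl_singleton
  have hpos : ∀ y ∈ W, 0 < (inner ℝ (Y y) (Y y) : ℝ) := fun y hy ↦
    lt_of_le_of_ne real_inner_self_nonneg (Ne.symm hy.2)
  refine ⟨fun y ↦ (√(inner ℝ (Y y) (Y y)))⁻¹ • Y y, W, hWopen,
    ⟨⟨hxs', hx⟩, inner_self_ne_zero.2 hYx⟩, fun y hy ↦ hy.1.2, fun y hy ↦ ?_, fun y hy ↦ ⟨?_, ?_⟩⟩
  · have h1 : ContDiffAt ℝ ∞ (fun r : ℝ ↦ (√r)⁻¹) (inner ℝ (Y y) (Y y)) :=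
      (Real.contDiffAt_sqrt (hpos y hy).ne').inv (Real.sqrt_pos.2 (hpos y hy)).ne'
    have h2 : ContMDiffAt I 𝓘(ℝ) ∞ (fun y ↦ (√(inner ℝ (Y y) (Y y)))⁻¹) y :=
      ContMDiffAt.comp (g := fun r : ℝ ↦ (√r)⁻¹) (f := fun y ↦ (inner ℝ (Y y) (Y y) : ℝ)) y
        h1.contMDiffAt (hnorm.contMDiffAt (hopen.mem_nhds hy.1))
    exact (h2.smul_section (hYsmooth.contMDiffAt (hopen.mem_nhds hy.1))).contMDiffWithinAt
  · exact Submodule.smul_mem _ _ (hYmem y hy.1.2)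
  · rw [norm_smul, norm_inv, Real.norm_of_nonneg (Real.sqrt_nonneg _), real_inner_self_eq_norm_sq,
      Real.sqrt_sq (norm_nonneg _), inv_mul_cancel₀]
    exact norm_ne_zero_iff.2 (inner_self_ne_zero.1 (hpos y hy).ne')

end IsSimpleTwoEigen

end Eigenfields

/-! ### The Codazzi equation evaluated on eigenfields -/

section CodazziCalculus

variable {E : Type*} [NormedAddCommGroup E] [NormedSpace ℝ E] [FiniteDimensional ℝ E]
  {H : Type*} [TopologicalSpace H] {I : ModelWithCorners ℝ E H}
  {M : Type*} [TopologicalSpace M] [ChartedSpace H M] [IsManifold I ∞ M]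
  [RiemannianBundle (fun x : M ↦ TangentSpace I x)]
  [IsContMDiffRiemannianBundle I ∞ E (fun x : M ↦ TangentSpace I x)]

theorem mvfderiv_congr_of_eventuallyEq {f g : M → ℝ} {x : M} (hfg : f =ᶠ[𝓝 x] g) :
    ∀ v : TangentSpace I x, mvfderiv I f x v = mvfderiv I g x v := by
  intro v
  have h1 : mfderiv I 𝓘(ℝ, ℝ) f x = mfderiv I 𝓘(ℝ, ℝ) g x := hfg.mfderiv_eq
  change mfderiv I 𝓘(ℝ, ℝ) f x v = mfderiv I 𝓘(ℝ, ℝ) g x v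
  rw [h1]
  rfl

theorem mvfderiv_eq_zero_of_eventually_const {f : M → ℝ} {x : M} {c : ℝ}
    (hf : ∀ᶠ y in 𝓝 x, f y = c) (v : TangentSpace I x) : mvfderiv I f x v = 0 := by
  rw [mvfderiv_congr_of_eventuallyEq (g := fun _ ↦ c) hf]
  simp [mvfderiv, mfderiv_const]

theorem leviCivita_congr {Y Z : Π x : M, TangentSpace I x} {x : M} (hY : MDiffAt (T% Y) x)
    (hZ : MDiffAt (T% Z) x) (h : ∀ᶠ y in 𝓝 x, Y y = Z y) :
    leviCivita I M Y x = leviCivita I M Z x :=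
  (leviCivita I M).isCovariantDerivativeOn (s := univ) |>.congr_of_eventuallyEq hY hZ univ_mem h

namespace IsSimpleTwoEigen

variable {A : Π x : M, TangentSpace I x →L[ℝ] TangentSpace I x} {μ lam : M → ℝ} {U : Set M}

theorem leviCivita_apply_eigenfield (h : IsSimpleTwoEigen A μ lam U) {x : M}
    {Y : Π x : M, TangentSpace I x} (hY : MDiffAt (T% Y) x) {f : M → ℝ} (hf : MDiffAt f x)
    (hYf : ∀ᶠ y in 𝓝 x, Y y ∈ eigenDist A f y) (v : TangentSpace I x) :
    leviCivita I M (fun y ↦ A y (Y y)) x v =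
      f x • leviCivita I M Y x v + mvfderiv I f x v • Y x := by
  have h1 : MDiffAt (T% (fun y ↦ A y (Y y))) x :=
    (h.isCodazzi.smooth.mdifferentiableAt (by simp)).clm_bundle_apply hY
  have h2 := leviCivita_congr h1 (hf.smul_section hY) (by
    filter_upwards [hYf] with y hy
    exact mem_mu.1 hy)
  rw [h2]
  have h3 := (leviCivita I M).isCovariantDerivativeOn (s := univ) |>.leibniz hY hf
  change (leviCivita I M).toFun (f • Y) x v = _
  rw [h3]
  rfl

theorem inner_apply_left (h : IsSimpleTwoEigen A μ lam U) {x : M} {f : M → ℝ}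
    {u w : TangentSpace I x} (hw : w ∈ eigenDist A f x) :
    inner ℝ (A x u) w = f x * inner ℝ u w := by
  rw [h.isCodazzi.selfAdjoint, mem_mu.1 hw, real_inner_smul_right]

/-- Here dim V_λ = n − 1 ≥ 2 enters: one Gram–Schmidt step on a vector of V_λ outside the line of
`v`. For `v = 0` the quotient in that step is 0 and nothing is subtracted. -/
theorem exists_orthogonal_lam (h : IsSimpleTwoEigen A μ lam U) {x : M} (hx : x ∈ U)
    {v : TangentSpace I x} (hv : v ∈ eigenDist A lam x) :
    ∃ w ∈ eigenDist A lam x, w ≠ 0 ∧ inner ℝ v w = 0 := by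
  have hfin := h.finrank_lam hx
  have h3 := h.three_le
  obtain ⟨u, hu, huv⟩ : ∃ u ∈ eigenDist A lam x, u ∉ Submodule.span ℝ {v} := by
    by_contra! hcon
    have := Submodule.finrank_mono (show eigenDist A lam x ≤ Submodule.span ℝ {v} from hcon)
    have h1 := finrank_span_finset_le_card (R := ℝ) ({v} : Finset (TangentSpace I x))
    rw [Finset.coe_singleton, Finset.card_singleton, Set.finrank] at h1
    omega
  refine ⟨u - (inner ℝ v u / inner ℝ v v) • v, Submodule.sub_mem _ hu
    (Submodule.smul_mem _ _ hv), fun h0 ↦ huv ?_, ?_⟩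
  · rw [_root_.sub_eq_zero] at h0
    rw [h0]
    exact Submodule.smul_mem _ _ (Submodule.mem_span_singleton_self v)
  · rw [inner_sub_right, real_inner_smul_right]
    by_cases hv0 : v = 0
    · simp [hv0]
    · rw [div_mul_cancel₀ _ (inner_self_ne_zero.2 hv0), sub_self]

/-- The multiple eigenfunction is constant along its eigendistribution. -/
theorem mvfderiv_lam_eq_zero (h : IsSimpleTwoEigen A μ lam U) {x : M} (hx : x ∈ U)
    {v : TangentSpace I x} (hv : v ∈ eigenDist A lam x) : mvfderiv I lam x v = 0 := by
  obtain ⟨w, hw, hw0, hvw⟩ := h.exists_orthogonal_lam hx hv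
  obtain ⟨Y, hY, hYx, hYU⟩ := h.exists_extension_lam hx hv
  obtain ⟨Z, hZ, hZx, hZU⟩ := h.exists_extension_lam hx hw
  have hY' : MDiffAt (T% Y) x := hY.mdifferentiableAt (by simp)
  have hZ' : MDiffAt (T% Z) x := hZ.mdifferentiableAt (by simp)
  have hU := h.isOpen.mem_nhds hx
  have hlam := h.mdifferentiableAt_lam hx
  have hcod := h.isCodazzi.codazzi Y Z x hY' hZ'
  rw [h.leviCivita_apply_eigenfield hZ' hlam (mem_of_superset hU hZU),
    h.leviCivita_apply_eigenfield hY' hlam (mem_of_superset hU hYU), hYx, hZx] at hcod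
  -- Pairing with `w` cancels the terms with ∇_Y Z and with ∇_Z Y, as A is self-adjoint and A w = λ
  -- w. What remains is v(λ)|w|² = w(λ)⟨v, w⟩ = 0.
  have key := congrArg (fun u ↦ inner ℝ u w) hcod
  simp only [inner_sub_left, inner_add_left, real_inner_smul_left, h.inner_apply_left hw, hvw]
    at key
  have : mvfderiv I lam x v * inner ℝ w w = 0 := by linarith
  exact (mul_eq_zero.1 this).resolve_right (inner_self_ne_zero.2 hw0)

/-! ### The covariant derivative of the unit eigenfield -/

section UnitField

variable {T : Π x : M, TangentSpace I x} {x : M}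

/-- The two components of the Codazzi equation for a field `T` of eigenvectors for the simple
eigenfunction and an eigenvector `v` for the multiple one. -/
theorem codazzi_components (h : IsSimpleTwoEigen A μ lam U) (hx : x ∈ U) (hT : MDiffAt (T% T) x)
    (hTμ : ∀ᶠ y in 𝓝 x, T y ∈ eigenDist A μ y) {v : TangentSpace I x}
    (hv : v ∈ eigenDist A lam x) :
    (μ x - lam x) * inner ℝ v (leviCivita I M T x (T x)) =
      mvfderiv I μ x v * inner ℝ (T x) (T x) ∧
    ∀ w ∈ eigenDist A lam x, (μ x - lam x) * inner ℝ (leviCivita I M T x v) w =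
      mvfderiv I lam x (T x) * inner ℝ v w := by
  obtain ⟨Y, hY, hYx, hYU⟩ := h.exists_extension_lam hx hv
  have hY' : MDiffAt (T% Y) x := hY.mdifferentiableAt (by simp)
  have hU := h.isOpen.mem_nhds hx
  have hcod := h.isCodazzi.codazzi T Y x hT hY'
  rw [h.leviCivita_apply_eigenfield hY' (h.mdifferentiableAt_lam hx) (mem_of_superset hU hYU),
    h.leviCivita_apply_eigenfield hT (h.mdifferentiableAt_mu hx) hTμ, hYx] at hcod
  have hTx : T x ∈ eigenDist A μ x := hTμ.self_of_nhds
  constructor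
  · have key := congrArg (fun u ↦ inner ℝ u (T x)) hcod
    -- Differentiating ⟨Y, T⟩ = 0 along `T` trades ⟨∇_T Y, T⟩ for −⟨v, ∇_T T⟩.
    have hmet := leviCivita_metric hT hY' hT
    rw [mvfderiv_eq_zero_of_eventually_const (c := 0) (by
      filter_upwards [hTμ, hU] with y hy hyU
      rw [real_inner_comm]
      exact h.inner_eq_zero hyU hy (hYU y hyU)), hYx] at hmet
    have hvT : inner ℝ v (T x) = 0 := by
      rw [real_inner_comm]; exact h.inner_eq_zero hx hTx hv
    simp only [inner_sub_left, inner_add_left, real_inner_smul_left, h.inner_apply_left hTx, hvT]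
      at key
    linear_combination key - (μ x - lam x) * hmet
  · intro w hw
    have key := congrArg (fun u ↦ inner ℝ u w) hcod
    have hTw : inner ℝ (T x) w = 0 := h.inner_eq_zero hx hTx hw
    simp only [inner_sub_left, inner_add_left, real_inner_smul_left, h.inner_apply_left hw, hTw]
      at key
    linear_combination -key

theorem inner_leviCivita_self {T : Π x : M, TangentSpace I x} (hT : MDiffAt (T% T) x)
    (hT1 : ∀ᶠ y in 𝓝 x, ‖T y‖ = 1) (u : TangentSpace I x) :
    inner ℝ (leviCivita I M T x u) (T x) = 0 := by
  have hmet := leviCivita_metric (mdifferentiableAt_extend u) hT hT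
  rw [mvfderiv_eq_zero_of_eventually_const (c := 1) (by
    filter_upwards [hT1] with y hy
    rw [real_inner_self_eq_norm_sq, hy, one_pow]), real_inner_comm _ (T x),
    FiberBundle.extend_apply_self] at hmet
  linarith

theorem exists_smul_eq_of_mem_mu (h : IsSimpleTwoEigen A μ lam U) (hx : x ∈ U)
    {t : TangentSpace I x} (ht : t ∈ eigenDist A μ x) (ht0 : t ≠ 0) {u : TangentSpace I x}
    (hu : u ∈ eigenDist A μ x) : ∃ c : ℝ, c • t = u := by
  obtain ⟨c, hc⟩ := (finrank_eq_one_iff_of_nonzero' (⟨t, ht⟩ : eigenDist A μ x)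
    (fun h0 ↦ ht0 (congrArg Subtype.val h0))).1 (h.simple x hx) ⟨u, hu⟩
  exact ⟨c, congrArg Subtype.val hc⟩

theorem mem_lam_iff (h : IsSimpleTwoEigen A μ lam U) (hx : x ∈ U)
    {t : TangentSpace I x} (ht : t ∈ eigenDist A μ x) (ht0 : t ≠ 0) {u : TangentSpace I x} :
    u ∈ eigenDist A lam x ↔ inner ℝ t u = 0 := by
  refine ⟨fun hu ↦ h.inner_eq_zero hx ht hu, fun hu ↦ h.mem_lam_of_orthogonal hx fun s hs ↦ ?_⟩
  obtain ⟨c, rfl⟩ := h.exists_smul_eq_of_mem_mu hx ht ht0 hs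
  rw [real_inner_smul_right, real_inner_comm, hu, mul_zero]

/-- The covariant derivative of the unit eigenfield, if the simple eigenfunction is constant along
the eigendistribution of the multiple one. -/
theorem inner_leviCivita_unit_field (h : IsSimpleTwoEigen A μ lam U) (hx : x ∈ U)
    (hT : MDiffAt (T% T) x) (hTμ : ∀ᶠ y in 𝓝 x, T y ∈ eigenDist A μ y ∧ ‖T y‖ = 1)
    (hμ : ∀ v ∈ eigenDist A lam x, mvfderiv I μ x v = 0) (u w : TangentSpace I x) :
    inner ℝ (leviCivita I M T x u) w = mvfderiv I lam x (T x) / (μ x - lam x) *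
      (inner ℝ u w - inner ℝ (T x) u * inner ℝ (T x) w) := by
  have hne := h.sub_ne_zero hx
  obtain ⟨hTx, hT1⟩ := hTμ.self_of_nhds
  have hT11 : inner ℝ (T x) (T x) = (1 : ℝ) := by
    rw [real_inner_self_eq_norm_sq, hT1, one_pow]
  have hT0 : T x ≠ 0 := fun h0 ↦ by simp [h0] at hT11
  have hproj : ∀ z : TangentSpace I x, z - (inner ℝ (T x) z : ℝ) • T x ∈ eigenDist A lam x := by
    intro z
    rw [h.mem_lam_iff hx hTx hT0, inner_sub_right, real_inner_smul_right, hT11]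
    ring
  have hTμ' := hTμ.mono fun _ hy ↦ hy.1
  have hself := inner_leviCivita_self hT (hTμ.mono fun _ hy ↦ hy.2)
  -- As μ has no derivative along V_λ, ∇_T T is orthogonal to V_λ; it is also orthogonal to `T`.
  have hTT : ∀ v ∈ eigenDist A lam x, inner ℝ (leviCivita I M T x (T x)) v = 0 := fun v hv ↦ by
    have := (h.codazzi_components hx hT hTμ' hv).1
    rw [hμ v hv, zero_mul, real_inner_comm] at this
    exact (mul_eq_zero.1 this).resolve_left hne
  set u' := u - (inner ℝ (T x) u : ℝ) • T x with hu'
  set w' := w - (inner ℝ (T x) w : ℝ) • T x with hw'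
  have hu : u = u' + (inner ℝ (T x) u : ℝ) • T x := by rw [hu']; abel
  have hw : w = w' + (inner ℝ (T x) w : ℝ) • T x := by rw [hw']; abel
  have h1 := (h.codazzi_components hx hT hTμ' (hproj u)).2 _ (hproj w)
  have h2 : inner ℝ u' w' = inner ℝ u w - inner ℝ (T x) u * inner ℝ (T x) w := by
    rw [hu', hw', inner_sub_left, inner_sub_right, inner_sub_right, real_inner_smul_left,
      real_inner_smul_left, real_inner_smul_right, real_inner_smul_right, hT11,
      real_inner_comm (T x) u]
    ring
  -- Only the V_λ-components `u'` and `w'` contribute, by the two orthogonality relations above.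
  have h3 : inner ℝ (leviCivita I M T x u) w = inner ℝ (leviCivita I M T x u') w' := by
    conv_lhs => rw [hu, hw]
    rw [map_add, map_smul, inner_add_left, inner_add_right, inner_add_right, real_inner_smul_left,
      real_inner_smul_left, real_inner_smul_right, hself u', hTT _ (hproj w), real_inner_smul_right,
      hself (T x)]
    ring
  rw [h3, ← h2, div_mul_eq_mul_div, eq_div_iff hne, ← h1]
  ring

end UnitField

end IsSimpleTwoEigen

end CodazziCalculus

/-! ### Coordinate fields of a local parametrization -/

theorem contDiffAt_clm_of_apply {D F G : Type*} [NormedAddCommGroup D] [NormedSpace ℝ D]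
    [NormedAddCommGroup F] [NormedSpace ℝ F] [FiniteDimensional ℝ F] [NormedAddCommGroup G]
    [NormedSpace ℝ G] {n : WithTop ℕ∞} {f : D → F →L[ℝ] G} {z : D}
    (hf : ∀ v, ContDiffAt ℝ n (fun y ↦ f y v) z) : ContDiffAt ℝ n f z := by
  let d := Module.finrank ℝ F
  have hd : d = Module.finrank ℝ (Fin d → ℝ) := (Module.finrank_fin_fun ℝ).symm
  let e₁ := ContinuousLinearEquiv.ofFinrankEq hd
  let e₂ := (e₁.arrowCongr (1 : G ≃L[ℝ] G)).trans (ContinuousLinearEquiv.piRing (Fin d))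
  rw [← Function.id_comp f, ← e₂.symm_comp_self]
  exact e₂.symm.contDiff.contDiffAt.comp z (contDiffAt_pi.mpr fun i ↦ hf _)

theorem two_le_infty : (2 : WithTop ℕ∞) ≤ ∞ :=
  WithTop.coe_le_coe.2 (le_top : (2 : ℕ∞) ≤ ⊤)

section CoordinateFields

variable {E : Type*} [NormedAddCommGroup E] [NormedSpace ℝ E] [FiniteDimensional ℝ E]
  {H : Type*} [TopologicalSpace H] {I : ModelWithCorners ℝ E H}
  {M : Type*} [TopologicalSpace M] [ChartedSpace H M] [IsManifold I ∞ M]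
  {E₀ : Type*} [NormedAddCommGroup E₀] [NormedSpace ℝ E₀] [FiniteDimensional ℝ E₀]

variable (I) in
/-- `e` is a smooth local parametrization: it and its inverse are smooth. -/
structure IsSmoothParam (e : OpenPartialHomeomorph E₀ M) : Prop where
  smooth : ContMDiffOn 𝓘(ℝ, E₀) I ∞ e e.source
  smooth_symm : ContMDiffOn I 𝓘(ℝ, E₀) ∞ e.symm e.target

variable (I) in
/-- The coordinate field on `M` of a local parametrization in the direction of `v`. -/
def coordField (e : OpenPartialHomeomorph E₀ M) (v : E₀) : Π x : M, TangentSpace I x :=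
  mpullback I 𝓘(ℝ, E₀) e.symm (fun y : E₀ ↦ (show TangentSpace 𝓘(ℝ, E₀) y from v))

namespace IsSmoothParam

variable {e : OpenPartialHomeomorph E₀ M}

theorem mdifferentiable (he : IsSmoothParam I e) : e.MDifferentiable 𝓘(ℝ, E₀) I :=
  ⟨he.smooth.mdifferentiableOn (by simp), he.smooth_symm.mdifferentiableOn (by simp)⟩

theorem contMDiffAt (he : IsSmoothParam I e) {z : E₀} (hz : z ∈ e.source) :
    ContMDiffAt 𝓘(ℝ, E₀) I ∞ e z := he.smooth.contMDiffAt (e.open_source.mem_nhds hz)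

theorem contMDiffAt_symm (he : IsSmoothParam I e) {x : M} (hx : x ∈ e.target) :
    ContMDiffAt I 𝓘(ℝ, E₀) ∞ e.symm x := he.smooth_symm.contMDiffAt (e.open_target.mem_nhds hx)

theorem mfderiv_symm_inverse (he : IsSmoothParam I e) {z : E₀} (hz : z ∈ e.source) (v : E₀) :
    mfderiv I 𝓘(ℝ, E₀) e.symm (e z) (mfderiv 𝓘(ℝ, E₀) I e z v) = v :=
  DFunLike.congr_fun (he.mdifferentiable.symm_comp_deriv hz) v

theorem isInvertible_mfderiv_symm (he : IsSmoothParam I e) {x : M} (hx : x ∈ e.target) :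
    (mfderiv I 𝓘(ℝ, E₀) e.symm x).IsInvertible :=
  ⟨he.mdifferentiable.symm.mfderiv hx, rfl⟩

theorem coordField_apply (he : IsSmoothParam I e) {z : E₀} (hz : z ∈ e.source) (v : E₀) :
    coordField I e v (e z) = mfderiv 𝓘(ℝ, E₀) I e z v := by
  have hbij := he.mdifferentiable.symm.mfderiv_bijective (e.map_source hz)
  apply hbij.injective
  refine Eq.trans ?_ (he.mfderiv_symm_inverse hz v).symm
  obtain ⟨L, hL⟩ := he.isInvertible_mfderiv_symm (e.map_source hz)
  change mfderiv I 𝓘(ℝ, E₀) e.symm (e z) ((mfderiv I 𝓘(ℝ, E₀) e.symm (e z)).inverse _) = _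
  rw [← hL, ContinuousLinearMap.inverse_equiv]
  exact L.apply_symm_apply _

theorem contMDiffAt_coordField (he : IsSmoothParam I e) {x : M} (hx : x ∈ e.target) (v : E₀) :
    ContMDiffAt I I.tangent ∞ (T% (coordField I e v)) x := by
  refine ContMDiffAt.mpullback_vectorField_preimage (n := ∞) ?_ (he.contMDiffAt_symm hx)
    (he.isInvertible_mfderiv_symm hx) (by simp)
  exact contMDiffAt_vectorSpace_iff_contDiffAt.2 contDiffAt_const

theorem mdifferentiableAt_coordField (he : IsSmoothParam I e) {x : M} (hx : x ∈ e.target)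
    (v : E₀) : MDiffAt (T% (coordField I e v)) x :=
  (he.contMDiffAt_coordField hx v).mdifferentiableAt (by simp)

/-- Coordinate fields are pullbacks of constant fields, which commute, and pullback respects
brackets. -/
theorem mlieBracket_coordField (he : IsSmoothParam I e) {x : M} (hx : x ∈ e.target) (v w : E₀) :
    mlieBracket I (coordField I e v) (coordField I e w) x = 0 := by
  have hconst : ∀ u : E₀, MDifferentiableAt 𝓘(ℝ, E₀) 𝓘(ℝ, E₀).tangent
      (fun y : E₀ ↦ (⟨y, u⟩ : TangentBundle 𝓘(ℝ, E₀) E₀)) (e.symm x) := fun u ↦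
    ((contMDiffAt_vectorSpace_iff_contDiffAt (V := fun _ ↦ u) (n := 1)).2
      contDiffAt_const).mdifferentiableAt one_ne_zero
  have : IsManifold I (minSmoothness ℝ 2) M :=
    IsManifold.of_le (n := ∞) (by rw [minSmoothness_of_isRCLikeNormedField]; exact two_le_infty)
  have h := mpullback_mlieBracket (n := ∞) (hconst v) (hconst w) (he.contMDiffAt_symm hx)
    (by rw [minSmoothness_of_isRCLikeNormedField]; exact two_le_infty)
  refine h.symm.trans ?_
  have h0 : mlieBracket 𝓘(ℝ, E₀) (fun _ : E₀ ↦ v) (fun _ : E₀ ↦ w) (e.symm x) = 0 := by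
    refine (congrFun mlieBracketWithin_univ _).symm.trans ?_
    refine (congrFun mlieBracketWithin_eq_lieBracketWithin _).trans ?_
    simp [lieBracketWithin]
    rfl
  exact (congrArg (mfderiv I 𝓘(ℝ, E₀) e.symm x).inverse h0).trans (map_zero _)

theorem fderiv_comp (he : IsSmoothParam I e) {φ : M → ℝ} {z : E₀} (hz : z ∈ e.source)
    (hφ : MDiffAt φ (e z)) (v : E₀) :
    fderiv ℝ (fun y ↦ φ (e y)) z v = mvfderiv I φ (e z) (coordField I e v (e z)) := by
  rw [he.coordField_apply hz, ← mfderiv_eq_fderiv]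
  have := mfderiv_comp z hφ ((he.contMDiffAt hz).mdifferentiableAt (by simp))
  exact DFunLike.congr_fun this v

theorem contDiffAt_comp (he : IsSmoothParam I e) {φ : M → ℝ} {z : E₀} (hz : z ∈ e.source)
    (hφ : ContMDiffAt I 𝓘(ℝ) ∞ φ (e z)) : ContDiffAt ℝ ∞ (fun y ↦ φ (e y)) z :=
  (hφ.comp z (he.contMDiffAt hz)).contDiffAt

variable [RiemannianBundle (fun x : M ↦ TangentSpace I x)]
  [IsContMDiffRiemannianBundle I ∞ E (fun x : M ↦ TangentSpace I x)]

theorem fderiv_inner (he : IsSmoothParam I e) {Y Z : Π x : M, TangentSpace I x} {z : E₀}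
    (hz : z ∈ e.source) (hY : MDiffAt (T% Y) (e z)) (hZ : MDiffAt (T% Z) (e z)) (v : E₀) :
    fderiv ℝ (fun y ↦ (inner ℝ (Y (e y)) (Z (e y)) : ℝ)) z v =
      inner ℝ (leviCivita I M Y (e z) (coordField I e v (e z))) (Z (e z)) +
        inner ℝ (Y (e z)) (leviCivita I M Z (e z) (coordField I e v (e z))) := by
  rw [← leviCivita_metric (he.mdifferentiableAt_coordField (e.map_source hz) v) hY hZ]
  exact he.fderiv_comp (φ := fun x ↦ (inner ℝ (Y x) (Z x) : ℝ)) hz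
    (mdifferentiableAt_inner hY hZ) v

theorem leviCivita_coordField_comm (he : IsSmoothParam I e) {x : M} (hx : x ∈ e.target)
    (v w : E₀) : leviCivita I M (coordField I e v) x (coordField I e w x) =
      leviCivita I M (coordField I e w) x (coordField I e v x) := by
  have h := (leviCivita I M).torsion_eq_zero_iff.1 leviCivita_torsion
    (he.mdifferentiableAt_coordField hx w) (he.mdifferentiableAt_coordField hx v)
  rw [he.mlieBracket_coordField hx, sub_eq_zero] at h
  exact h

theorem contDiffAt_inner (he : IsSmoothParam I e) {Y Z : Π x : M, TangentSpace I x} {z : E₀}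
    (hz : z ∈ e.source) (hY : ContMDiffAt I I.tangent ∞ (T% Y) (e z))
    (hZ : ContMDiffAt I I.tangent ∞ (T% Z) (e z)) :
    ContDiffAt ℝ ∞ (fun y ↦ (inner ℝ (Y (e y)) (Z (e y)) : ℝ)) z :=
  he.contDiffAt_comp (φ := fun x ↦ (inner ℝ (Y x) (Z x) : ℝ)) hz
    (ContMDiffAt.inner_bundle (E := fun x : M ↦ TangentSpace I x) (b := fun y : M ↦ y) hY hZ)

end IsSmoothParam

variable [RiemannianBundle (fun x : M ↦ TangentSpace I x)]
  [IsContMDiffRiemannianBundle I ∞ E (fun x : M ↦ TangentSpace I x)]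

/-- The one-form dual to the vector field `T`, in the coordinates given by `e`. -/
def dualForm (e : OpenPartialHomeomorph E₀ M) (T : Π x : M, TangentSpace I x) (z : E₀) :
    E₀ →L[ℝ] ℝ :=
  LinearMap.toContinuousLinearMap
    { toFun v := inner ℝ (T (e z)) (mfderiv 𝓘(ℝ, E₀) I e z v)
      map_add' v w := by
        refine Eq.trans ?_ (inner_add_right _ _ _)
        exact congrArg _ (map_add (mfderiv 𝓘(ℝ, E₀) I e z) v w)
      map_smul' c v := by
        refine Eq.trans ?_ (real_inner_smul_right _ _ _)
        exact congrArg _ (map_smul (mfderiv 𝓘(ℝ, E₀) I e z) c v) }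

theorem dualForm_apply (e : OpenPartialHomeomorph E₀ M) (T : Π x : M, TangentSpace I x) (z v : E₀) :
    dualForm e T z v = inner ℝ (T (e z)) (mfderiv 𝓘(ℝ, E₀) I e z v) := rfl

namespace IsSmoothParam

variable {e : OpenPartialHomeomorph E₀ M} {T : Π x : M, TangentSpace I x}

theorem dualForm_apply_eq (he : IsSmoothParam I e) {z : E₀} (hz : z ∈ e.source) (v : E₀) :
    dualForm e T z v = inner ℝ (T (e z)) (coordField I e v (e z)) := by
  rw [dualForm_apply, he.coordField_apply hz]

theorem eventually_dualForm_apply_eq (he : IsSmoothParam I e) {z : E₀} (hz : z ∈ e.source)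
    (v : E₀) : (fun y ↦ dualForm e T y v) =ᶠ[𝓝 z]
      fun y ↦ inner ℝ (T (e y)) (coordField I e v (e y)) := by
  filter_upwards [e.open_source.mem_nhds hz] with y hy using he.dualForm_apply_eq hy v

theorem contDiffAt_dualForm (he : IsSmoothParam I e) {z : E₀} (hz : z ∈ e.source)
    (hT : ContMDiffAt I I.tangent ∞ (T% T) (e z)) : ContDiffAt ℝ ∞ (dualForm e T) z := by
  refine contDiffAt_clm_of_apply fun v ↦ (he.contDiffAt_inner hz hT
    (he.contMDiffAt_coordField (e.map_source hz) v)).congr_of_eventuallyEq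
      (he.eventually_dualForm_apply_eq hz v)

theorem fderiv_dualForm (he : IsSmoothParam I e) {z : E₀} (hz : z ∈ e.source)
    (hT : ContMDiffAt I I.tangent ∞ (T% T) (e z)) (v w : E₀) :
    fderiv ℝ (dualForm e T) z v w =
      inner ℝ (leviCivita I M T (e z) (coordField I e v (e z))) (coordField I e w (e z)) +
        inner ℝ (T (e z)) (leviCivita I M (coordField I e w) (e z) (coordField I e v (e z))) := by
  have hd := (he.contDiffAt_dualForm hz hT).differentiableAt (by simp)
  have h1 : fderiv ℝ (fun y ↦ dualForm e T y w) z v = fderiv ℝ (dualForm e T) z v w := by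
    have := fderiv_clm_apply hd (differentiableAt_const w)
    rw [this]
    simp
  rw [← h1, (he.eventually_dualForm_apply_eq hz w).fderiv_eq,
    he.fderiv_inner hz (hT.mdifferentiableAt (by simp))
      (he.mdifferentiableAt_coordField (e.map_source hz) w)]

/-- The exterior derivative of the dual one-form is the skew-symmetric part of `∇ T`. -/
theorem fderiv_dualForm_sub (he : IsSmoothParam I e) {z : E₀} (hz : z ∈ e.source)
    (hT : ContMDiffAt I I.tangent ∞ (T% T) (e z)) (v w : E₀) :
    fderiv ℝ (dualForm e T) z v w - fderiv ℝ (dualForm e T) z w v =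
      inner ℝ (leviCivita I M T (e z) (coordField I e v (e z))) (coordField I e w (e z)) -
      inner ℝ (leviCivita I M T (e z) (coordField I e w (e z))) (coordField I e v (e z)) := by
  -- The terms ⟨T, ∇_{∂_v} ∂_w⟩ are symmetric in v and w, because coordinate fields commute and
  -- there is no torsion; they cancel.
  rw [he.fderiv_dualForm hz hT, he.fderiv_dualForm hz hT,
    he.leviCivita_coordField_comm (e.map_source hz) w v]
  ring

end IsSmoothParam

end CoordinateFields

/-! ### The four conditions -/

section Conditions

variable {E : Type*} [NormedAddCommGroup E] [NormedSpace ℝ E] [FiniteDimensional ℝ E]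
  {H : Type*} [TopologicalSpace H] {I : ModelWithCorners ℝ E H}
  {M : Type*} [TopologicalSpace M] [ChartedSpace H M] [IsManifold I ∞ M]
  {E₀ : Type*} [NormedAddCommGroup E₀] [NormedSpace ℝ E₀] [FiniteDimensional ℝ E₀]
  {e : OpenPartialHomeomorph E₀ M} {T : Π x : M, TangentSpace I x}

variable (I) in
/-- The vector field on `E₀` that represents the vector field `T` in the coordinates `e`. -/
def coordRep (e : OpenPartialHomeomorph E₀ M) (T : Π x : M, TangentSpace I x) (z : E₀) : E₀ :=
  mpullback 𝓘(ℝ, E₀) I e T z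

namespace IsSmoothParam

theorem isInvertible_mfderiv (he : IsSmoothParam I e) {z : E₀} (hz : z ∈ e.source) :
    (mfderiv 𝓘(ℝ, E₀) I e z).IsInvertible :=
  ⟨he.mdifferentiable.mfderiv hz, rfl⟩

theorem mfderiv_coordRep (he : IsSmoothParam I e) {z : E₀} (hz : z ∈ e.source) :
    mfderiv 𝓘(ℝ, E₀) I e z (coordRep (E₀ := E₀) I e T z) = T (e z) := by
  obtain ⟨L, hL⟩ := he.isInvertible_mfderiv hz
  change mfderiv 𝓘(ℝ, E₀) I e z ((mfderiv 𝓘(ℝ, E₀) I e z).inverse _) = _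
  rw [← hL]
  erw [ContinuousLinearMap.inverse_equiv]
  exact L.apply_symm_apply _

theorem contDiffAt_coordRep (he : IsSmoothParam I e) {z : E₀} (hz : z ∈ e.source)
    (hT : ContMDiffAt I I.tangent ∞ (T% T) (e z)) : ContDiffAt ℝ ∞ (coordRep I e T) z :=
  contMDiffAt_vectorSpace_iff_contDiffAt.1 (ContMDiffAt.mpullback_vectorField_preimage (n := ∞)
    hT (he.contMDiffAt hz) (he.isInvertible_mfderiv hz) (by simp))

theorem exists_coordField_eq (he : IsSmoothParam I e) {x : M} (hx : x ∈ e.target)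
    (u : TangentSpace I x) : ∃ v : E₀, coordField I e v x = u := by
  obtain ⟨v, hv⟩ := (he.mdifferentiable.mfderiv_bijective (e.map_target hx)).surjective
    ((e.right_inv hx).symm ▸ u)
  refine ⟨v, ?_⟩
  have := he.coordField_apply (e.map_target hx) v
  rw [hv] at this
  generalize_proofs hp at this
  revert this hp
  generalize e (e.symm x) = x'
  rintro rfl h
  exact h

/-- Smooth vector fields have smooth integral curves. -/
theorem exists_integralCurve (he : IsSmoothParam I e) {W : Set M} (hW : IsOpen W)
    (hT : ContMDiffOn I I.tangent ∞ (T% T) W) {x : M} (hxW : x ∈ W) (hx : x ∈ e.target) :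
    ∃ (δ : ℝ) (γ : ℝ → M), 0 < δ ∧ γ 0 = x ∧ ContMDiffOn 𝓘(ℝ, ℝ) I ∞ γ (Ioo (-δ) δ) ∧
      ∀ t ∈ Ioo (-δ) δ, γ t ∈ W ∧ velocity I γ t = T (γ t) := by
  have hW' : IsOpen (e.source ∩ e ⁻¹' W) := e.isOpen_inter_preimage hW
  have hX : ContDiffOn ℝ ∞ (coordRep I e T) (e.source ∩ e ⁻¹' W) := fun z hz ↦
    (he.contDiffAt_coordRep hz.1 (hT.contMDiffAt (hW.mem_nhds hz.2))).contDiffWithinAt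
  obtain ⟨δ, φ, hδ, hφ, hφ0, hφX⟩ := exists_local_flow hW' hX
    (x₀ := e.symm x) ⟨e.map_target hx, by rwa [mem_preimage, e.right_inv hx]⟩
  have hmem := Metric.mem_ball_self (x := e.symm x) hδ
  have hcurve : ContDiffOn ℝ ∞ (fun s ↦ φ (s, e.symm x)) (Ioo (-δ) δ) :=
    hφ.comp (contDiff_id.prodMk contDiff_const).contDiffOn fun s hs ↦ ⟨hs, hmem⟩
  refine ⟨δ, fun s ↦ e (φ (s, e.symm x)), hδ, ?_, ?_, fun t ht ↦ ?_⟩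
  · change e (φ (0, e.symm x)) = x
    rw [hφ0 _ hmem, e.right_inv hx]
  · exact he.smooth.comp hcurve.contMDiffOn fun s hs ↦ (hφX s hs _ hmem).1.1
  · obtain ⟨h1, h2⟩ := hφX t ht _ hmem
    refine ⟨h1.2, ?_⟩
    have h3 := (((he.contMDiffAt h1.1).mdifferentiableAt (by simp)).hasMFDerivAt).comp t
      h2.hasFDerivAt.hasMFDerivAt
    rw [velocity]
    refine (DFunLike.congr_fun h3.mfderiv (1 : ℝ)).trans ?_
    refine Eq.trans ?_ (he.mfderiv_coordRep h1.1 (T := T))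
    refine congrArg (mfderiv 𝓘(ℝ, E₀) I e (φ (t, e.symm x))) ?_
    exact one_smul ℝ (coordRep (E₀ := E₀) I e T (φ (t, e.symm x)))

end IsSmoothParam

namespace IsSimpleTwoEigen

variable [RiemannianBundle (fun x : M ↦ TangentSpace I x)]
  [IsContMDiffRiemannianBundle I ∞ E (fun x : M ↦ TangentSpace I x)]
  {A : Π x : M, TangentSpace I x →L[ℝ] TangentSpace I x} {μ lam : M → ℝ} {U : Set M}

/-- Since tr A = μ + (n − 1)λ and λ is already constant along V_λ, the derivatives of tr A and μ
along V_λ agree. -/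
theorem isConstantAlong_of_trace (h : IsSimpleTwoEigen A μ lam U)
    (htr : IsConstantAlong A lam U (trace A)) : IsConstantAlong A lam U μ := by
  intro x hx v hv
  have hlam := h.mdifferentiableAt_lam hx
  have hμ := h.mdifferentiableAt_mu hx
  have hlamc : MDiffAt (fun y ↦ ((Module.finrank ℝ E : ℝ) - 1) * lam y) x :=
    mdifferentiableAt_const.mul hlam
  have h1 := htr x hx v hv
  rw [mvfderiv_congr_of_eventuallyEq
    (g := fun y ↦ μ y + ((Module.finrank ℝ E : ℝ) - 1) * lam y)
    (by filter_upwards [h.isOpen.mem_nhds hx] with y hy using h.trace_eq hy),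
    mvfderiv_fun_add hμ hlamc,
    mvfderiv_fun_mul mdifferentiableAt_const hlam] at h1
  have h2 : mvfderiv I (fun _ : M ↦ (Module.finrank ℝ E : ℝ) - 1) x v = 0 :=
    mvfderiv_eq_zero_of_eventually_const (Eventually.of_forall fun _ ↦ rfl) v
  simpa [h.mvfderiv_lam_eq_zero hx hv, h2] using h1

/-- If the unit field `T` of eigenvectors for `μ` is autoparallel at `x`, then `μ` is constant
along the eigendistribution of `lam` at `x`. -/
theorem mvfderiv_mu_eq_zero (h : IsSimpleTwoEigen A μ lam U) {x : M} (hx : x ∈ U)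
    (hT : MDiffAt (T% T) x) (hTμ : ∀ᶠ y in 𝓝 x, T y ∈ eigenDist A μ y ∧ ‖T y‖ = 1)
    {v : TangentSpace I x} (hv : v ∈ eigenDist A lam x)
    (hTT : inner ℝ v (leviCivita I M T x (T x)) = 0) : mvfderiv I μ x v = 0 := by
  have h1 := (h.codazzi_components hx hT (hTμ.mono fun _ hy ↦ hy.1) hv).1
  rwa [hTT, mul_zero, real_inner_self_eq_norm_sq, hTμ.self_of_nhds.2, one_pow, mul_one, eq_comm]
    at h1

/-- The integral curve of the unit field `T` through `x` is a geodesic, and `T` itself extends its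
velocity; hence ∇_T T = 0 at `x`. -/
theorem isConstantAlong_of_geodesics (h : IsSimpleTwoEigen A μ lam U)
    (hparam : ∀ x : M, ∃ e : OpenPartialHomeomorph E M, IsSmoothParam I e ∧ x ∈ e.target)
    (hgeo : IntegralCurvesAreGeodesics A μ U) : IsConstantAlong A lam U μ := by
  intro x hx v hv
  obtain ⟨T, W, hW, hxW, hWU, hT, hTμ⟩ := h.exists_unit_field hx
  obtain ⟨e, he, hxe⟩ := hparam x
  obtain ⟨δ, γ, hδ, rfl, hγ, hγT⟩ := he.exists_integralCurve hW hT hxW hxe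
  have h0 : (0 : ℝ) ∈ Ioo (-δ) δ := ⟨by linarith, hδ⟩
  have hT0 := (hT.contMDiffAt (hW.mem_nhds hxW)).mdifferentiableAt (by simp)
  have := hgeo γ _ isOpen_Ioo ordConnected_Ioo hγ (fun t ht ↦ by
    obtain ⟨h1, h2⟩ := hγT t ht
    rw [h2]
    exact ⟨hWU h1, hTμ _ h1⟩) 0 h0 T hT0
      (by filter_upwards [isOpen_Ioo.mem_nhds h0] with s hs using (hγT s hs).2.symm)
  rw [(hγT 0 h0).2] at this
  exact h.mvfderiv_mu_eq_zero hx hT0 (mem_of_superset (hW.mem_nhds hxW) hTμ) hv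
    (by rw [this, inner_zero_right])

theorem inner_grad (f : M → ℝ) (x : M) (v : TangentSpace I x) :
    inner ℝ (grad I f x) v = mvfderiv I f x v := by
  rw [grad, InnerProductSpace.toDual_symm_apply]

/-- The form dual to a gradient is df, and second derivatives of `f` in coordinates are symmetric.
-/
theorem fderiv_dualForm_symm_of_grad (he : IsSmoothParam I e) {z : E₀} (hz : z ∈ e.source)
    {f : M → ℝ} (hf : ContMDiffAt I 𝓘(ℝ, ℝ) ∞ f (e z))
    (hfT : ∀ᶠ x in 𝓝 (e z), grad I f x = T x) (v w : E₀) :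
    fderiv ℝ (dualForm e T) z v w = fderiv ℝ (dualForm e T) z w v := by
  have hfd : ∀ᶠ x in 𝓝 (e z), MDiffAt f x :=
    (contMDiffAt_iff_contMDiffAt_nhds (by simp)).1 (hf.of_le (m := 1) (by simp)) |>.mono fun _ hy ↦
      hy.mdifferentiableAt one_ne_zero
  have hev : dualForm e T =ᶠ[𝓝 z] fderiv ℝ (fun y ↦ f (e y)) := by
    filter_upwards [e.open_source.mem_nhds hz, (e.continuousAt hz).eventually (hfd.and hfT)]
      with y hy hy2
    ext v
    rw [he.fderiv_comp hy hy2.1, he.dualForm_apply_eq hy, ← hy2.2, inner_grad]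
  rw [hev.fderiv_eq]
  exact ((he.contDiffAt_comp hz hf).isSymmSndFDerivAt
    (by rw [minSmoothness_of_isRCLikeNormedField]; exact two_le_infty)).eq v w

/-- A closed dual form makes ∇T symmetric, so ⟨∇_T T, v⟩ = ⟨∇_v T, T⟩, which is 0 because `T` has
unit length. -/
theorem isConstantAlong_of_gradients (h : IsSimpleTwoEigen A μ lam U)
    (hparam : ∀ x : M, ∃ e : OpenPartialHomeomorph E M, IsSmoothParam I e ∧ x ∈ e.target)
    (hgrad : UnitFieldsAreLocallyGradients A μ U) : IsConstantAlong A lam U μ := by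
  intro x hx v hv
  obtain ⟨T, W, hW, hxW, hWU, hT, hTμ⟩ := h.exists_unit_field hx
  obtain ⟨f, hf, hfT⟩ := hgrad T W hW hWU hT hTμ x hxW
  obtain ⟨e, he, hxe⟩ := hparam x
  have hTx := hT.contMDiffAt (hW.mem_nhds hxW)
  have hTev : ∀ᶠ y in 𝓝 x, T y ∈ eigenDist A μ y ∧ ‖T y‖ = 1 :=
    mem_of_superset (hW.mem_nhds hxW) hTμ
  refine h.mvfderiv_mu_eq_zero hx (hTx.mdifferentiableAt (by simp)) hTev hv ?_
  obtain ⟨z, hz, rfl⟩ : ∃ z ∈ e.source, e z = x := ⟨e.symm x, e.map_target hxe, e.right_inv hxe⟩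
  have hsymm := he.fderiv_dualForm_sub hz hTx
  obtain ⟨a, rfl⟩ := he.exists_coordField_eq hxe v
  obtain ⟨b, hb⟩ := he.exists_coordField_eq hxe (T (e z))
  have h1 := hsymm a b
  rw [fderiv_dualForm_symm_of_grad he hz hf hfT, sub_self, hb, inner_leviCivita_self
    (hTx.mdifferentiableAt (by simp)) (hTev.mono fun _ hy ↦ hy.2), zero_sub, real_inner_comm] at h1
  linarith

end IsSimpleTwoEigen

end Conditions

/-! ### Adapted parametrizations -/

section Adapted

variable {E : Type*} [NormedAddCommGroup E] [NormedSpace ℝ E] [FiniteDimensional ℝ E]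
  {H : Type*} [TopologicalSpace H] {I : ModelWithCorners ℝ E H}
  {M : Type*} [TopologicalSpace M] [ChartedSpace H M] [IsManifold I ∞ M]
  [RiemannianBundle (fun x : M ↦ TangentSpace I x)]
  [IsContMDiffRiemannianBundle I ∞ E (fun x : M ↦ TangentSpace I x)]
  {E' : Type*} [NormedAddCommGroup E'] [InnerProductSpace ℝ E'] [FiniteDimensional ℝ E']
  {A : Π x : M, TangentSpace I x →L[ℝ] TangentSpace I x} {μ lam : M → ℝ} {U : Set M}

/-- A local parametrization by a product `(-δ, δ) × E'` whose first coordinate field is the unit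
field `T` of eigenvectors for `μ`, and whose other coordinate fields are orthogonal to it. -/
structure IsAdaptedParam (A : Π x : M, TangentSpace I x →L[ℝ] TangentSpace I x) (μ : M → ℝ)
    (U : Set M) (T : Π x : M, TangentSpace I x) (δ : ℝ)
    (Φ : OpenPartialHomeomorph (ℝ × E') M) : Prop where
  isSmoothParam : IsSmoothParam I Φ
  pos : 0 < δ
  source_eq : Φ.source = Ioo (-δ) δ ×ˢ univ
  target_subset : Φ.target ⊆ U
  contMDiffAt : ∀ x ∈ Φ.target, ContMDiffAt I I.tangent ∞ (T% T) x
  eigen : ∀ x ∈ Φ.target, T x ∈ eigenDist A μ x ∧ ‖T x‖ = 1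
  base : ∀ x ∈ Φ.target, coordField I Φ ((1, 0) : ℝ × E') x = T x
  orthogonal : ∀ x ∈ Φ.target, ∀ v : E', inner ℝ (T x) (coordField I Φ ((0, v) : ℝ × E') x) = 0

theorem inner_self_of_norm_eq_one {x : M} {v : TangentSpace I x} (hv : ‖v‖ = 1) :
    inner ℝ v v = (1 : ℝ) := by
  rw [real_inner_self_eq_norm_sq, hv, one_pow]

/-- If the simple eigenfunction is constant along the eigendistribution of the multiple one, then
adapted parametrizations exist near every point. -/
theorem IsSimpleTwoEigen.exists_isAdaptedParam (h : IsSimpleTwoEigen A μ lam U)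
    (hdim : Module.finrank ℝ E = Module.finrank ℝ E' + 1)
    (hμ : IsConstantAlong A lam U μ) {p : M} (hp : p ∈ U)
    {e : OpenPartialHomeomorph E M} (he : IsSmoothParam I e) (hpe : p ∈ e.target) :
    ∃ (T : Π x : M, TangentSpace I x) (δ : ℝ) (Φ : OpenPartialHomeomorph (ℝ × E') M),
      p ∈ Φ.target ∧ IsAdaptedParam A μ U T δ Φ := by
  obtain ⟨T, W, hW, hpW, hWU, hT, hTμ⟩ := h.exists_unit_field hp
  have hTat : ∀ z ∈ e.source ∩ e ⁻¹' W, ContMDiffAt I I.tangent ∞ (T% T) (e z) := fun z hz ↦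
    hT.contMDiffAt (hW.mem_nhds hz.2)
  -- The dual form is closed: its exterior derivative is the skew part of ∇T, and the formula for ∇T
  -- is symmetric.
  have hsymm : ∀ z ∈ e.source ∩ e ⁻¹' W, ∀ u v,
      fderiv ℝ (dualForm e T) z u v = fderiv ℝ (dualForm e T) z v u := by
    intro z hz u v
    have h1 := he.fderiv_dualForm_sub hz.1 (hTat z hz) u v
    have hTz := (hTat z hz).mdifferentiableAt (by simp)
    have hTev : ∀ᶠ y in 𝓝 (e z), T y ∈ eigenDist A μ y ∧ ‖T y‖ = 1 :=
      mem_of_superset (hW.mem_nhds hz.2) hTμ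
    rw [h.inner_leviCivita_unit_field (hWU hz.2) hTz hTev (hμ _ (hWU hz.2)),
      h.inner_leviCivita_unit_field (hWU hz.2) hTz hTev (hμ _ (hWU hz.2)),
      real_inner_comm (coordField I e u (e z)) (coordField I e v (e z))] at h1
    linear_combination h1
  have hX1 : ∀ z ∈ e.source ∩ e ⁻¹' W, dualForm e T z (coordRep I e T z) = 1 := fun z hz ↦ by
    rw [dualForm_apply, he.mfderiv_coordRep hz.1, inner_self_of_norm_eq_one (hTμ _ hz.2).2]
  -- Straighten `T` and its dual form together. That the form vanishes on the fibre directions means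
  -- that these are orthogonal to `T`.
  obtain ⟨δ, Ψ, hδ, hsrc, hpΨ, hΨW, hΨ, hΨs, hΨd⟩ := exists_rectification (E' := E') hdim
    (e.isOpen_inter_preimage hW)
    (fun z hz ↦ (he.contDiffAt_coordRep hz.1 (hTat z hz)).contDiffWithinAt)
    (fun z hz ↦ (he.contDiffAt_dualForm hz.1 (hTat z hz)).contDiffWithinAt) hsymm hX1
    (x₀ := e.symm p) ⟨e.map_target hpe, by rwa [mem_preimage, e.right_inv hpe]⟩
  have hsrc' : (Ψ.trans e).source = Ψ.source := by
    rw [OpenPartialHomeomorph.trans_source, inter_eq_left]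
    exact fun z hz ↦ (hΨW (Ψ.map_source hz)).1
  have hparam : IsSmoothParam I (Ψ.trans e) :=
    { smooth := by
        rw [hsrc']
        exact he.smooth.comp hΨ.contMDiffOn fun z hz ↦ (hΨW (Ψ.map_source hz)).1
      smooth_symm := by
        rw [OpenPartialHomeomorph.trans_target]
        exact hΨs.contMDiffOn.comp (he.smooth_symm.mono inter_subset_left) fun x hx ↦ hx.2 }
  have htgt : (Ψ.trans e).target ⊆ W := fun x hx ↦ by
    rw [OpenPartialHomeomorph.trans_target] at hx
    have := (hΨW hx.2).2
    rwa [mem_preimage, e.right_inv hx.1] at this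
  have hderiv : ∀ z ∈ Ψ.source, ∀ v : ℝ × E', coordField I (Ψ.trans e) v (e (Ψ z)) =
      mfderiv 𝓘(ℝ, E) I e (Ψ z) (fderiv ℝ Ψ z v) := fun z hz v ↦ by
    have h1 := hparam.coordField_apply (hsrc'.symm ▸ hz) v
    refine h1.trans ?_
    have h2 := (((he.contMDiffAt (hΨW (Ψ.map_source hz)).1).mdifferentiableAt
      (by simp)).hasMFDerivAt).comp z ((hΨ.contDiffAt (Ψ.open_source.mem_nhds hz)).differentiableAt
        (by simp)).hasFDerivAt.hasMFDerivAt
    exact DFunLike.congr_fun h2.mfderiv v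
  have hex : ∀ x ∈ (Ψ.trans e).target, ∃ z ∈ Ψ.source, e (Ψ z) = x := fun x hx ↦
    ⟨(Ψ.trans e).symm x, hsrc' ▸ (Ψ.trans e).map_target hx, (Ψ.trans e).right_inv hx⟩
  refine ⟨T, δ, Ψ.trans e, ?_, hparam, hδ, hsrc'.trans hsrc, htgt.trans hWU,
    fun x hx ↦ hT.contMDiffAt (hW.mem_nhds (htgt hx)), fun x hx ↦ hTμ x (htgt hx), ?_, ?_⟩
  · rw [OpenPartialHomeomorph.trans_target]
    exact ⟨hpe, hpΨ⟩
  · intro x hx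
    obtain ⟨z, hz, rfl⟩ := hex x hx
    rw [hderiv z hz, (hΨd z hz).1, he.mfderiv_coordRep (hΨW (Ψ.map_source hz)).1]
  · intro x hx v
    obtain ⟨z, hz, rfl⟩ := hex x hx
    rw [hderiv z hz, ← dualForm_apply, (hΨd z hz).2]

namespace IsAdaptedParam

variable {T : Π x : M, TangentSpace I x} {δ : ℝ} {Φ : OpenPartialHomeomorph (ℝ × E') M}

theorem mem_source (hΦ : IsAdaptedParam A μ U T δ Φ) {t : ℝ} (ht : t ∈ Ioo (-δ) δ) (y : E') :
    (t, y) ∈ Φ.source := by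
  rw [hΦ.source_eq]
  exact ⟨ht, mem_univ _⟩

theorem mem_target (hΦ : IsAdaptedParam A μ U T δ Φ) {t : ℝ} (ht : t ∈ Ioo (-δ) δ) (y : E') :
    Φ (t, y) ∈ Φ.target := Φ.map_source (hΦ.mem_source ht y)

theorem ne_zero (hΦ : IsAdaptedParam A μ U T δ Φ) {x : M} (hx : x ∈ Φ.target) : T x ≠ 0 :=
  fun h0 ↦ by simpa [h0] using (hΦ.eigen x hx).2

theorem coordField_mem (hΦ : IsAdaptedParam A μ U T δ Φ) (h : IsSimpleTwoEigen A μ lam U)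
    {x : M} (hx : x ∈ Φ.target) (v : E') : coordField I Φ ((0, v) : ℝ × E') x ∈ eigenDist A lam x :=
  (h.mem_lam_iff (hΦ.target_subset hx) (hΦ.eigen x hx).1 (hΦ.ne_zero hx)).2
    (hΦ.orthogonal x hx v)

theorem hasDerivAt_comp (hΦ : IsAdaptedParam A μ U T δ Φ) {f : M → ℝ} {t : ℝ}
    (ht : t ∈ Ioo (-δ) δ) (y : E') (hf : MDiffAt f (Φ (t, y))) :
    HasDerivAt (fun s ↦ f (Φ (s, y))) (mvfderiv I f (Φ (t, y)) (T (Φ (t, y)))) t := by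
  have hz := hΦ.mem_source ht y
  have hd : DifferentiableAt ℝ (fun z ↦ f (Φ z)) (t, y) :=
    (hf.comp (t, y) ((hΦ.isSmoothParam.contMDiffAt hz).mdifferentiableAt
      (by simp))).differentiableAt
  have h1 := hd.hasFDerivAt.comp_hasDerivAt t ((hasDerivAt_id t).prodMk (hasDerivAt_const t y))
  rw [hΦ.isSmoothParam.fderiv_comp hz hf, hΦ.base _ (hΦ.mem_target ht y)] at h1
  exact h1

/-- A function that is constant along the eigendistribution of `lam` does not depend on the second
coordinate. -/
theorem comp_eq (hΦ : IsAdaptedParam A μ U T δ Φ) (h : IsSimpleTwoEigen A μ lam U) {f : M → ℝ}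
    (hf : ∀ x ∈ U, MDiffAt f x) (hfc : IsConstantAlong A lam U f) {t : ℝ} (ht : t ∈ Ioo (-δ) δ)
    (y : E') : f (Φ (t, y)) = f (Φ (t, 0)) := by
  have hd : ∀ y : E', HasFDerivAt (fun y ↦ f (Φ (t, y))) (0 : E' →L[ℝ] ℝ) y := fun y ↦ by
    have hz := hΦ.mem_source ht y
    have hU := hΦ.target_subset (hΦ.mem_target ht y)
    have hd : DifferentiableAt ℝ (fun z ↦ f (Φ z)) (t, y) :=
      ((hf _ hU).comp (t, y) ((hΦ.isSmoothParam.contMDiffAt hz).mdifferentiableAt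
        (by simp))).differentiableAt
    have h1 := hd.hasFDerivAt.comp y (hasFDerivAt_prodMk_right t y)
    refine h1.congr_fderiv ?_
    ext v
    change fderiv ℝ (fun z ↦ f (Φ z)) (t, y) (0, v) = 0
    rw [hΦ.isSmoothParam.fderiv_comp hz (hf _ hU)]
    exact hfc _ hU _ (hΦ.coordField_mem h (hΦ.mem_target ht y) v)
  exact is_const_of_fderiv_eq_zero (𝕜 := ℝ) (fun y ↦ (hd y).differentiableAt)
    (fun y ↦ (hd y).fderiv) y 0

variable (Φ) in
/-- The metric coefficients in the fibre directions. -/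
def gram (v w : E') (z : ℝ × E') : ℝ :=
  inner ℝ (coordField I Φ ((0, v) : ℝ × E') (Φ z)) (coordField I Φ ((0, w) : ℝ × E') (Φ z))

theorem contDiffAt_gram (hΦ : IsAdaptedParam A μ U T δ Φ) (v w : E') {z : ℝ × E'}
    (hz : z ∈ Φ.source) : ContDiffAt ℝ ∞ (gram (I := I) Φ v w) z :=
  hΦ.isSmoothParam.contDiffAt_inner hz
    (hΦ.isSmoothParam.contMDiffAt_coordField (Φ.map_source hz) _)
    (hΦ.isSmoothParam.contMDiffAt_coordField (Φ.map_source hz) _)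

theorem gram_self_pos (hΦ : IsAdaptedParam A μ U T δ Φ) {v : E'} (hv : v ≠ 0) {z : ℝ × E'}
    (hz : z ∈ Φ.source) : 0 < gram (I := I) Φ v v z := by
  refine real_inner_self_pos.2 fun h0 ↦ hv ?_
  rw [hΦ.isSmoothParam.coordField_apply hz] at h0
  have h1 := hΦ.isSmoothParam.mfderiv_symm_inverse hz ((0, v) : ℝ × E')
  rw [h0, map_zero] at h1
  exact (congrArg Prod.snd h1).symm

/-- The evolution of the metric coefficients. -/
theorem hasDerivAt_gram (hΦ : IsAdaptedParam A μ U T δ Φ) (h : IsSimpleTwoEigen A μ lam U)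
    (hμ : IsConstantAlong A lam U μ) (v w : E') {t : ℝ} (ht : t ∈ Ioo (-δ) δ) (y : E') :
    HasDerivAt (fun s ↦ gram (I := I) Φ v w (s, y))
      (2 * (mvfderiv I lam (Φ (t, y)) (T (Φ (t, y))) / (μ (Φ (t, y)) - lam (Φ (t, y)))) *
        gram (I := I) Φ v w (t, y)) t := by
  have hz := hΦ.mem_source ht y
  have hx := hΦ.mem_target ht y
  have hU := hΦ.target_subset hx
  have hs := hΦ.isSmoothParam
  have h1 := ((hΦ.contDiffAt_gram v w hz).differentiableAt (by simp)).hasFDerivAt.comp_hasDerivAt t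
    ((hasDerivAt_id t).prodMk (hasDerivAt_const t y))
  refine h1.congr_deriv ?_
  refine (hs.fderiv_inner hz (hs.mdifferentiableAt_coordField hx _)
    (hs.mdifferentiableAt_coordField hx _) _).trans ?_
  have hT := (hΦ.contMDiffAt _ hx).mdifferentiableAt (n := ∞) (by simp)
  have hcov : leviCivita I M (coordField I Φ ((1, 0) : ℝ × E')) (Φ (t, y)) =
      leviCivita I M T (Φ (t, y)) :=
    leviCivita_congr (hs.mdifferentiableAt_coordField hx _) hT
      (by filter_upwards [Φ.open_target.mem_nhds hx] with x hx using hΦ.base x hx)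
  have hTev : ∀ᶠ x in 𝓝 (Φ (t, y)), T x ∈ eigenDist A μ x ∧ ‖T x‖ = 1 :=
    mem_of_superset (Φ.open_target.mem_nhds hx) hΦ.eigen
  -- Since ∇_{∂_t} ∂_v = ∇_{∂_v} T, each of the two terms of the product rule equals η⟨∂_v, ∂_w⟩.
  rw [hs.leviCivita_coordField_comm hx, hs.leviCivita_coordField_comm hx (0, w), hcov,
    h.inner_leviCivita_unit_field hU hT hTev (hμ _ hU),
    real_inner_comm (leviCivita I M T (Φ (t, y)) _),
    h.inner_leviCivita_unit_field hU hT hTev (hμ _ hU), hΦ.orthogonal _ hx, hΦ.orthogonal _ hx,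
    real_inner_comm (coordField I Φ (0, v) (Φ (t, y)))]
  simp only [gram]
  ring

/-- Both λ and μ depend on t alone, and T(λ) is the t-derivative of λ; so η is a function of t. -/
theorem logDeriv_eq (hΦ : IsAdaptedParam A μ U T δ Φ) (h : IsSimpleTwoEigen A μ lam U)
    (hμ : IsConstantAlong A lam U μ) {t : ℝ} (ht : t ∈ Ioo (-δ) δ) (y : E') :
    mvfderiv I lam (Φ (t, y)) (T (Φ (t, y))) / (μ (Φ (t, y)) - lam (Φ (t, y))) =
      mvfderiv I lam (Φ (t, 0)) (T (Φ (t, 0))) / (μ (Φ (t, 0)) - lam (Φ (t, 0))) := by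
  have hlam : ∀ x ∈ U, MDiffAt lam x := fun x hx ↦ h.mdifferentiableAt_lam hx
  have hlamc : IsConstantAlong A lam U lam := fun x hx v hv ↦ h.mvfderiv_lam_eq_zero hx hv
  have h1 := hΦ.hasDerivAt_comp ht y (hlam _ (hΦ.target_subset (hΦ.mem_target ht y)))
  have h2 := hΦ.hasDerivAt_comp ht 0 (hlam _ (hΦ.target_subset (hΦ.mem_target ht 0)))
  rw [h1.unique (h2.congr_of_eventuallyEq (by
    filter_upwards [isOpen_Ioo.mem_nhds ht] with s hs using hΦ.comp_eq h hlam hlamc hs y)),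
    hΦ.comp_eq h hlam hlamc ht, hΦ.comp_eq h (fun x hx ↦ h.mdifferentiableAt_mu hx) hμ ht]

theorem zero_mem (hΦ : IsAdaptedParam A μ U T δ Φ) : (0 : ℝ) ∈ Ioo (-δ) δ :=
  ⟨neg_lt_zero.2 hΦ.pos, hΦ.pos⟩

variable (Φ) in
/-- The warping function, measured along the coordinate field in the direction of `v`. -/
def warping (v : E') (t : ℝ) : ℝ :=
  √(gram (I := I) Φ v v (t, 0) / gram (I := I) Φ v v (0, 0))

theorem warping_radicand_pos (hΦ : IsAdaptedParam A μ U T δ Φ) {v : E'} (hv : v ≠ 0) {t : ℝ}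
    (ht : t ∈ Ioo (-δ) δ) : 0 < gram (I := I) Φ v v (t, 0) / gram (I := I) Φ v v (0, 0) :=
  div_pos (hΦ.gram_self_pos hv (hΦ.mem_source ht 0))
    (hΦ.gram_self_pos hv (hΦ.mem_source hΦ.zero_mem 0))

theorem warping_pos (hΦ : IsAdaptedParam A μ U T δ Φ) {v : E'} (hv : v ≠ 0) {t : ℝ}
    (ht : t ∈ Ioo (-δ) δ) : 0 < warping (I := I) Φ v t :=
  Real.sqrt_pos.2 (hΦ.warping_radicand_pos hv ht)

theorem warping_sq (hΦ : IsAdaptedParam A μ U T δ Φ) {v : E'} (hv : v ≠ 0) {t : ℝ}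
    (ht : t ∈ Ioo (-δ) δ) : warping (I := I) Φ v t ^ 2 =
      gram (I := I) Φ v v (t, 0) / gram (I := I) Φ v v (0, 0) :=
  Real.sq_sqrt (hΦ.warping_radicand_pos hv ht).le

theorem contDiffOn_warping (hΦ : IsAdaptedParam A μ U T δ Φ) {v : E'} (hv : v ≠ 0) :
    ContDiffOn ℝ ∞ (warping (I := I) Φ v) (Ioo (-δ) δ) := fun t ht ↦ by
  have h1 : ContDiffAt ℝ ∞ (fun s : ℝ ↦ gram (I := I) Φ v v (s, 0)) t :=
    (hΦ.contDiffAt_gram v v (hΦ.mem_source ht 0)).comp t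
      (contDiffAt_id.prodMk contDiffAt_const)
  exact ((h1.div_const _).sqrt (hΦ.warping_radicand_pos hv ht).ne').contDiffWithinAt

/-- For fixed `y`, both coefficients solve the same scalar linear equation g' = 2η(t)g, so their
quotient is constant in t. The reference coefficient, taken along `v₀` over the origin, is positive
and serves as denominator. -/
theorem gram_eq (hΦ : IsAdaptedParam A μ U T δ Φ) (h : IsSimpleTwoEigen A μ lam U)
    (hμ : IsConstantAlong A lam U μ) {v₀ : E'} (hv₀ : v₀ ≠ 0) (v w : E') {t : ℝ}
    (ht : t ∈ Ioo (-δ) δ) (y : E') : gram (I := I) Φ v w (t, y) =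
      warping (I := I) Φ v₀ t ^ 2 * gram (I := I) Φ v w (0, y) := by
  have hpos : ∀ s ∈ Ioo (-δ) δ, 0 < gram (I := I) Φ v₀ v₀ (s, 0) := fun s hs ↦
    hΦ.gram_self_pos hv₀ (hΦ.mem_source hs 0)
  have hd : ∀ s ∈ Ioo (-δ) δ, HasDerivAt
      (fun s ↦ gram (I := I) Φ v w (s, y) / gram (I := I) Φ v₀ v₀ (s, 0)) 0 s := fun s hs ↦ by
    refine ((hΦ.hasDerivAt_gram h hμ v w hs y).div (hΦ.hasDerivAt_gram h hμ v₀ v₀ hs 0)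
      (hpos s hs).ne').congr_deriv ?_
    rw [hΦ.logDeriv_eq h hμ hs y, div_eq_zero_iff]
    left
    ring
  have hc := isOpen_Ioo.is_const_of_deriv_eq_zero isPreconnected_Ioo
    (fun s hs ↦ (hd s hs).differentiableAt.differentiableWithinAt)
    (fun s hs ↦ (hd s hs).deriv) ht hΦ.zero_mem
  rw [hΦ.warping_sq hv₀ ht]
  have h1 := (hpos t ht).ne'
  have h2 := (hpos 0 hΦ.zero_mem).ne'
  field_simp at hc ⊢
  linear_combination hc

/-- If the warping function is constant then so is the multiple eigenfunction. -/
theorem eigenvalue_const_of_warping_const (hΦ : IsAdaptedParam A μ U T δ Φ)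
    (h : IsSimpleTwoEigen A μ lam U) (hμ : IsConstantAlong A lam U μ) {v : E'} (hv : v ≠ 0) {c : ℝ}
    (hc : ∀ t ∈ Ioo (-δ) δ, warping (I := I) Φ v t = c) :
    ∀ x ∈ Φ.target, lam x = lam (Φ (0, 0)) := by
  have hlam : ∀ x ∈ U, MDiffAt lam x := fun x hx ↦ h.mdifferentiableAt_lam hx
  have hd : ∀ t ∈ Ioo (-δ) δ, HasDerivAt (fun s ↦ lam (Φ (s, 0))) 0 t := fun t ht ↦ by
    have hx := hΦ.target_subset (hΦ.mem_target ht 0)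
    refine (hΦ.hasDerivAt_comp ht 0 (hlam _ hx)).congr_deriv ?_
    have hpos := hΦ.gram_self_pos hv (hΦ.mem_source ht 0)
    have h0 := hΦ.gram_self_pos hv (hΦ.mem_source hΦ.zero_mem 0)
    -- A constant warping function makes the coefficient g constant, so 2ηg = 0 with g > 0; thus η =
    -- 0 and T(λ) = 0.
    have hconst : HasDerivAt (fun s ↦ gram (I := I) Φ v v (s, 0)) 0 t := by
      refine (hasDerivAt_const t (c ^ 2 * gram (I := I) Φ v v (0, 0))).congr_of_eventuallyEq ?_
      filter_upwards [isOpen_Ioo.mem_nhds ht] with s hs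
      rw [← hc s hs, hΦ.warping_sq hv hs, div_mul_cancel₀ _ h0.ne']
    have h1 := (hΦ.hasDerivAt_gram h hμ v v ht 0).unique hconst
    have h2 := (mul_eq_zero.1 ((mul_eq_zero.1 h1).resolve_right hpos.ne')).resolve_left two_ne_zero
    exact (div_eq_zero_iff.1 h2).resolve_right (h.sub_ne_zero hx)
  intro x hx
  obtain ⟨⟨t, y⟩, hz, rfl⟩ : ∃ z ∈ Φ.source, Φ z = x :=
    ⟨Φ.symm x, Φ.map_target hx, Φ.right_inv hx⟩
  rw [hΦ.source_eq] at hz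
  rw [hΦ.comp_eq h hlam (fun x hx v hv ↦ h.mvfderiv_lam_eq_zero hx hv) hz.1]
  exact isOpen_Ioo.is_const_of_deriv_eq_zero isPreconnected_Ioo
    (fun s hs ↦ (hd s hs).differentiableAt.differentiableWithinAt)
    (fun s hs ↦ (hd s hs).deriv) hz.1 hΦ.zero_mem

end IsAdaptedParam

end Adapted

/-! ### Metrics on vector spaces -/

section VectorSpaceMetric

variable {F : Type*} [NormedAddCommGroup F] [NormedSpace ℝ F] [FiniteDimensional ℝ F]

/-- The unit ball of a positive definite bilinear form is bounded. -/
theorem isVonNBounded_of_posDef (B : F →L[ℝ] F →L[ℝ] ℝ) (hB : ∀ v, v ≠ 0 → 0 < B v v) :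
    Bornology.IsVonNBounded ℝ {v : F | B v v < 1} := by
  rw [NormedSpace.isVonNBounded_iff]
  have hcont : Continuous fun v : F ↦ B v v := by fun_prop
  -- The sphere is empty only for the trivial space. Otherwise the minimum m > 0 of the form on the
  -- sphere gives m‖v‖² ≤ B v v < 1.
  rcases (Metric.sphere (0 : F) 1).eq_empty_or_nonempty with hS | hS
  · refine (Bornology.isBounded_singleton (x := (0 : F))).subset fun v _ ↦ ?_
    by_contra hv0
    have hv0' : ‖v‖ ≠ 0 := norm_ne_zero_iff.2 hv0
    have : ‖v‖⁻¹ • v ∈ Metric.sphere (0 : F) 1 := by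
      rw [mem_sphere_zero_iff_norm, norm_smul, norm_inv, norm_norm, inv_mul_cancel₀ hv0']
    rw [hS] at this
    exact this
  · have : ProperSpace F := FiniteDimensional.proper ℝ F
    obtain ⟨u, hu, hmin⟩ := (isCompact_sphere (0 : F) 1).exists_isMinOn hS hcont.continuousOn
    have hu1 : ‖u‖ = 1 := mem_sphere_zero_iff_norm.1 hu
    have hpos : 0 < B u u := hB u fun h0 ↦ by simp [h0] at hu1
    refine (Metric.isBounded_closedBall (x := (0 : F)) (r := √(1 / B u u))).subset fun v hv ↦ ?_
    rw [mem_closedBall_zero_iff]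
    refine Real.le_sqrt_of_sq_le ?_
    rcases eq_or_ne v 0 with rfl | hv0
    · simpa using hpos.le
    have hv0' : ‖v‖ ≠ 0 := norm_ne_zero_iff.2 hv0
    have h1 : B u u ≤ B (‖v‖⁻¹ • v) (‖v‖⁻¹ • v) := hmin (by
      rw [mem_sphere_zero_iff_norm, norm_smul, norm_inv, norm_norm, inv_mul_cancel₀ hv0'])
    simp only [map_smul, smul_apply, smul_eq_mul] at h1
    rw [le_div_iff₀ hpos]
    have h2 : ‖v‖ ^ 2 * B u u ≤ B v v := by
      calc ‖v‖ ^ 2 * B u u ≤ ‖v‖ ^ 2 * (‖v‖⁻¹ * (‖v‖⁻¹ * B v v)) := by gcongr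
        _ = B v v := by field_simp
    exact h2.trans (le_of_lt hv)

/-- A family of bilinear forms on a vector space, as forms on the tangent spaces. -/
def tangentForm (b : F → F →L[ℝ] F →L[ℝ] ℝ) (y : F) :
    TangentSpace 𝓘(ℝ, F) y →L[ℝ] TangentSpace 𝓘(ℝ, F) y →L[ℝ] ℝ := b y

/-- The Riemannian metric on a vector space given by a smooth family of bilinear forms. -/
def metricOfBilin (b : F → F →L[ℝ] F →L[ℝ] ℝ) (hb : ContDiff ℝ ∞ b)
    (hsymm : ∀ y v w, b y v w = b y w v) (hpos : ∀ y v, v ≠ 0 → 0 < b y v v) :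
    ContMDiffRiemannianMetric 𝓘(ℝ, F) ∞ F (fun y : F ↦ TangentSpace 𝓘(ℝ, F) y) where
  inner y := tangentForm b y
  symm y v w := hsymm y v w
  pos y v hv := hpos y v hv
  isVonNBounded y := isVonNBounded_of_posDef (b y) (hpos y)
  contMDiff := by
    intro x
    rw [contMDiffAt_section]
    refine hb.contDiffAt.contMDiffAt.congr_of_eventuallyEq (Eventually.of_forall fun y ↦ ?_)
    ext v w
    beta_reduce
    rw [hom_trivializationAt_apply]
    simp [ContinuousLinearMap.inCoordinates]
    rw [Trivialization.linearMapAt_apply, if_pos (by simp [hom_trivializationAt_baseSet, chartAt_self_eq]),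
      hom_trivializationAt_apply]
    simp [ContinuousLinearMap.inCoordinates]
    rfl

end VectorSpaceMetric

/-! ### Models with corners of a product -/

section ProductModel

variable {E : Type*} [NormedAddCommGroup E] [NormedSpace ℝ E]
  {H : Type*} [TopologicalSpace H] {I : ModelWithCorners ℝ E H}
  {M : Type*} [TopologicalSpace M] [ChartedSpace H M]
  {E' : Type*} [NormedAddCommGroup E'] [NormedSpace ℝ E']

theorem contMDiffOn_prod_model {f : ℝ × E' → M} {s : Set (ℝ × E')}
    (hf : ContMDiffOn 𝓘(ℝ, ℝ × E') I ∞ f s) :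
    ContMDiffOn (𝓘(ℝ, ℝ).prod 𝓘(ℝ, E')) I ∞ f s := by
  rw [← modelWithCornersSelf_prod, chartedSpaceSelf_prod]
  exact hf

theorem contMDiffOn_prod_model_target {f : M → ℝ × E'} {s : Set M}
    (hf : ContMDiffOn I 𝓘(ℝ, ℝ × E') ∞ f s) :
    ContMDiffOn I (𝓘(ℝ, ℝ).prod 𝓘(ℝ, E')) ∞ f s := by
  rw [← modelWithCornersSelf_prod, chartedSpaceSelf_prod]
  exact hf

/-- The product model and the model of the vector space ℝ × E' are equal but not by definition; the
derivative is compared after both structures have been generalized. -/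
theorem prodDeriv_eq [IsManifold I ∞ M] (f : ℝ × E' → M) (t : ℝ) (y : E') (a : ℝ) (v : E') :
    prodDeriv I 𝓘(ℝ, E') f t y a v = mfderiv 𝓘(ℝ, ℝ × E') I f (t, y) ((a, v) : ℝ × E') := by
  let r : E := mfderiv 𝓘(ℝ, ℝ × E') I f (t, y) ((a, v) : ℝ × E')
  have key : ∀ (J : ModelWithCorners ℝ (ℝ × E') (ℝ × E')) (c : ChartedSpace (ℝ × E') (ℝ × E')),
      J = 𝓘(ℝ, ℝ × E') → c = chartedSpaceSelf _ →
      (mfderiv J I f (t, y) ((a, v) : ℝ × E') : E) = r := by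
    rintro _ _ rfl rfl
    rfl
  exact key _ _ modelWithCornersSelf_prod.symm chartedSpaceSelf_prod

end ProductModel

/-! ### The warped product structure -/

section Splitting

variable {E : Type*} [NormedAddCommGroup E] [NormedSpace ℝ E] [FiniteDimensional ℝ E]
  {H : Type*} [TopologicalSpace H] {I : ModelWithCorners ℝ E H}
  {M : Type*} [TopologicalSpace M] [ChartedSpace H M] [IsManifold I ∞ M]
  {E₀ : Type*} [NormedAddCommGroup E₀] [NormedSpace ℝ E₀] [FiniteDimensional ℝ E₀]
  {E' : Type*} [NormedAddCommGroup E'] [InnerProductSpace ℝ E'] [FiniteDimensional ℝ E']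

theorem coordField_add (e : OpenPartialHomeomorph E₀ M) (v w : E₀) (x : M) :
    coordField I e (v + w) x = coordField I e v x + coordField I e w x :=
  map_add (mfderiv I 𝓘(ℝ, E₀) e.symm x).inverse _ _

theorem coordField_smul (e : OpenPartialHomeomorph E₀ M) (c : ℝ) (v : E₀) (x : M) :
    coordField I e (c • v) x = c • coordField I e v x :=
  map_smul (mfderiv I 𝓘(ℝ, E₀) e.symm x).inverse c _

variable [RiemannianBundle (fun x : M ↦ TangentSpace I x)]
  [IsContMDiffRiemannianBundle I ∞ E (fun x : M ↦ TangentSpace I x)]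
  {A : Π x : M, TangentSpace I x →L[ℝ] TangentSpace I x} {μ lam : M → ℝ} {U : Set M}
  {T : Π x : M, TangentSpace I x} {δ : ℝ} {Φ : OpenPartialHomeomorph (ℝ × E') M}

namespace IsAdaptedParam

theorem coordField_snd_add (v w : E') (x : M) : coordField I Φ ((0, v + w) : ℝ × E') x =
    coordField I Φ ((0, v) : ℝ × E') x + coordField I Φ ((0, w) : ℝ × E') x := by
  rw [← coordField_add, Prod.mk_add_mk, add_zero]

theorem coordField_snd_smul (c : ℝ) (v : E') (x : M) :
    coordField I Φ ((0, c • v) : ℝ × E') x = c • coordField I Φ ((0, v) : ℝ × E') x := by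
  rw [← coordField_smul, Prod.smul_mk, smul_zero]

variable (Φ) in
/-- The metric of the slice through the origin. -/
def fibreForm (y : E') : E' →L[ℝ] E' →L[ℝ] ℝ :=
  (LinearMap.mk₂ ℝ (fun v w : E' ↦ gram (I := I) Φ v w (0, y))
    (fun v v' w ↦ by rw [gram, coordField_snd_add, inner_add_left]; rfl)
    (fun c v w ↦ by rw [gram, coordField_snd_smul, real_inner_smul_left]; rfl)
    (fun v w w' ↦ by rw [gram, coordField_snd_add, inner_add_right]; rfl)
    (fun c v w ↦ by rw [gram, coordField_snd_smul, real_inner_smul_right]; rfl)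
    ).toContinuousBilinearMap

theorem contDiff_fibreForm (hΦ : IsAdaptedParam A μ U T δ Φ) :
    ContDiff ℝ ∞ (fibreForm (I := I) Φ) := by
  rw [contDiff_iff_contDiffAt]
  refine fun y ↦ contDiffAt_clm_of_apply fun v ↦ contDiffAt_clm_of_apply fun w ↦ ?_
  exact (hΦ.contDiffAt_gram v w (hΦ.mem_source hΦ.zero_mem y)).comp y
    (contDiffAt_const.prodMk contDiffAt_id)

/-- The metric of the slice through the origin, as a Riemannian metric. -/
def fibreMetric (hΦ : IsAdaptedParam A μ U T δ Φ) :
    ContMDiffRiemannianMetric 𝓘(ℝ, E') ∞ E' (fun y : E' ↦ TangentSpace 𝓘(ℝ, E') y) :=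
  metricOfBilin (fibreForm (I := I) Φ) hΦ.contDiff_fibreForm
    (fun y _ w ↦ real_inner_comm (coordField I Φ ((0, w) : ℝ × E') (Φ (0, y))) _)
    (fun y _ hv ↦ hΦ.gram_self_pos hv (hΦ.mem_source hΦ.zero_mem y))

theorem prodDeriv_eq_add (hΦ : IsAdaptedParam A μ U T δ Φ) {t : ℝ} (ht : t ∈ Ioo (-δ) δ) (y : E')
    (a : ℝ) (v : E') : prodDeriv I 𝓘(ℝ, E') Φ t y a v =
      a • T (Φ (t, y)) + coordField I Φ ((0, v) : ℝ × E') (Φ (t, y)) := by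
  rw [prodDeriv_eq, ← hΦ.isSmoothParam.coordField_apply (hΦ.mem_source ht y),
    ← hΦ.base _ (hΦ.mem_target ht y), ← coordField_smul, ← coordField_add]
  simp

theorem inner_prodDeriv (hΦ : IsAdaptedParam A μ U T δ Φ) {t : ℝ} (ht : t ∈ Ioo (-δ) δ) (y : E')
    (a b : ℝ) (v w : E') :
    inner ℝ (prodDeriv I 𝓘(ℝ, E') Φ t y a v) (prodDeriv I 𝓘(ℝ, E') Φ t y b w) =
      a * b + gram (I := I) Φ v w (t, y) := by
  have hx := hΦ.mem_target ht y
  rw [hΦ.prodDeriv_eq_add ht, hΦ.prodDeriv_eq_add ht, inner_add_left, inner_add_right,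
    inner_add_right, real_inner_smul_left, real_inner_smul_left, real_inner_smul_right,
    real_inner_smul_right, real_inner_comm (T (Φ (t, y))) (coordField I Φ ((0, v) : ℝ × E') _),
    hΦ.orthogonal _ hx, hΦ.orthogonal _ hx, inner_self_of_norm_eq_one (hΦ.eigen _ hx).2]
  simp only [gram]
  ring

theorem isWarpedProduct (hΦ : IsAdaptedParam A μ U T δ Φ) (h : IsSimpleTwoEigen A μ lam U)
    (hμ : IsConstantAlong A lam U μ) {v₀ : E'} (hv₀ : v₀ ≠ 0) :
    IsWarpedProduct (I := I) (Ioo (-δ) δ) (warping (I := I) Φ v₀) hΦ.fibreMetric Φ where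
  isOpen_base := isOpen_Ioo
  ordConnected_base := ordConnected_Ioo
  warping_smooth := hΦ.contDiffOn_warping hv₀
  warping_pos _ ht := hΦ.warping_pos hv₀ ht
  source_eq := hΦ.source_eq
  smooth := contMDiffOn_prod_model hΦ.isSmoothParam.smooth
  smooth_symm := contMDiffOn_prod_model_target hΦ.isSmoothParam.smooth_symm
  metric_eq _ ht y a b v w := (hΦ.inner_prodDeriv ht y a b v w).trans
    (congrArg (a * b + ·) (hΦ.gram_eq h hμ hv₀ v w ht y))

theorem isConsistent (hΦ : IsAdaptedParam A μ U T δ Φ) (h : IsSimpleTwoEigen A μ lam U) :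
    IsConsistent A μ lam 𝓘(ℝ, E') (Ioo (-δ) δ) Φ := by
  intro t ht y
  have hx := hΦ.mem_target ht y
  have hU := hΦ.target_subset hx
  have hTμ := (hΦ.eigen _ hx).1
  have hcoord0 : coordField I Φ ((0, 0) : ℝ × E') (Φ (t, y)) = 0 := by
    simpa using coordField_snd_smul (I := I) (Φ := Φ) 0 0 (Φ (t, y))
  refine ⟨Subset.antisymm ?_ fun u hu ↦ ?_, Subset.antisymm ?_ fun u hu ↦ ?_⟩
  · rintro _ ⟨a, rfl⟩
    refine (congrArg (· ∈ eigenDist A μ (Φ (t, y))) (hΦ.prodDeriv_eq_add ht y a 0)).mpr ?_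
    rw [hcoord0, add_zero]
    exact Submodule.smul_mem _ _ hTμ
  · obtain ⟨a, rfl⟩ := h.exists_smul_eq_of_mem_mu hU hTμ (hΦ.ne_zero hx) hu
    refine ⟨a, (hΦ.prodDeriv_eq_add ht y a 0).trans ?_⟩
    rw [hcoord0, add_zero]
  · rintro _ ⟨v, rfl⟩
    refine (congrArg (· ∈ eigenDist A lam (Φ (t, y))) (hΦ.prodDeriv_eq_add ht y 0 v)).mpr ?_
    rw [zero_smul, zero_add]
    exact hΦ.coordField_mem h hx v
  -- Expand `u` in coordinate fields; pairing with `T` shows that the `T`-component `a` vanishes.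
  · obtain ⟨⟨a, v⟩, hz⟩ := hΦ.isSmoothParam.exists_coordField_eq hx u
    have hdec : u = a • T (Φ (t, y)) + coordField I Φ ((0, v) : ℝ × E') (Φ (t, y)) := by
      rw [← hz, ← hΦ.base _ hx, ← coordField_smul, ← coordField_add]
      simp
    have ha : a = 0 := by
      have h1 := h.inner_eq_zero hU hTμ hu
      rwa [hdec, inner_add_right, real_inner_smul_right, hΦ.orthogonal _ hx,
        inner_self_of_norm_eq_one (hΦ.eigen _ hx).2, mul_one, add_zero] at h1
    subst ha
    exact ⟨v, (hΦ.prodDeriv_eq_add ht y 0 v).trans hdec.symm⟩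

end IsAdaptedParam

end Splitting

theorem isSmoothParam_chartAt_symm {E : Type*} [NormedAddCommGroup E] [NormedSpace ℝ E]
    {M : Type*} [TopologicalSpace M] [ChartedSpace E M] [IsManifold 𝓘(ℝ, E) ∞ M] (x : M) :
    IsSmoothParam 𝓘(ℝ, E) (chartAt E x).symm :=
  ⟨contMDiffOn_chart_symm, by simpa using contMDiffOn_chart⟩

end CodazziWarped
end
-- The local warped product theorem
open CodazziWarped in
theorem theorem1p2 {n : ℕ} (hn : 3 ≤ n)
    {M : Type*} [TopologicalSpace M] [ChartedSpace (EuclideanSpace ℝ (Fin n)) M]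
    [IsManifold (𝓡 n) ∞ M]
    [RiemannianBundle (fun x : M ↦ TangentSpace (𝓡 n) x)]
    [IsContMDiffRiemannianBundle (𝓡 n) ∞ (EuclideanSpace ℝ (Fin n))
      (fun x : M ↦ TangentSpace (𝓡 n) x)]
    (A : Π x : M, TangentSpace (𝓡 n) x →L[ℝ] TangentSpace (𝓡 n) x) (hA : IsCodazzi A)
    (p : M) (U : Set M) (hU : IsOpen U) (hpU : p ∈ U)
    (μ lam : M → ℝ) (hev : HasTwoEigenfunctionsOn A μ lam U)
    (hdim : ∀ x ∈ U, Module.finrank ℝ (eigenDist A μ x) = 1)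
    (hlam : ∀ W ∈ 𝓝 p, ¬ ∃ c : ℝ, ∀ x ∈ W, lam x = c)
    (hcond : IsConstantAlong A lam U (trace A) ∨
      IsConstantAlong A lam U μ ∨
      IntegralCurvesAreGeodesics A μ U ∨
      UnitFieldsAreLocallyGradients A μ U) :
    ∃ (N : Type) (_ : TopologicalSpace N) (_ : T2Space N) (_ : SecondCountableTopology N)
      (_ : ChartedSpace (EuclideanSpace ℝ (Fin (n - 1))) N) (_ : IsManifold (𝓡 (n - 1)) ∞ N)
      (h : ContMDiffRiemannianMetric (𝓡 (n - 1)) ∞ (EuclideanSpace ℝ (Fin (n - 1)))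
        (fun y : N ↦ TangentSpace (𝓡 (n - 1)) y))
      (J : Set ℝ) (F : ℝ → ℝ) (Φ : OpenPartialHomeomorph (ℝ × N) M),
      p ∈ Φ.target ∧ Φ.target ⊆ U ∧
      IsWarpedProduct (I := 𝓡 n) J F h Φ ∧
      IsConsistent A μ lam (𝓡 (n - 1)) J Φ ∧
      ¬ ∃ c : ℝ, ∀ t ∈ J, F t = c := by
  have h : IsSimpleTwoEigen A μ lam U :=
    { isCodazzi := hA, isOpen := hU, eigen := hev, simple := hdim, three_le := by simpa using hn }
  have hparam : ∀ x : M, ∃ e : OpenPartialHomeomorph (EuclideanSpace ℝ (Fin n)) M,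
      IsSmoothParam (𝓡 n) e ∧ x ∈ e.target := fun x ↦
    ⟨_, isSmoothParam_chartAt_symm x, mem_chart_source _ x⟩
  have hμ : IsConstantAlong A lam U μ := by
    rcases hcond with h1 | h1 | h1 | h1
    · exact h.isConstantAlong_of_trace h1
    · exact h1
    · exact h.isConstantAlong_of_geodesics hparam h1
    · exact h.isConstantAlong_of_gradients hparam h1
  obtain ⟨e, he, hpe⟩ := hparam p
  obtain ⟨T, δ, Φ, hp, hΦ⟩ := h.exists_isAdaptedParam
    (E' := EuclideanSpace ℝ (Fin (n - 1))) (by simp; omega) hμ hpU he hpe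
  have : Nonempty (Fin (n - 1)) := ⟨⟨0, by omega⟩⟩
  -- Any nonzero direction can serve to measure the warping function, since all metric coefficients
  -- scale alike.
  obtain ⟨v₀, hv₀⟩ := exists_ne (0 : EuclideanSpace ℝ (Fin (n - 1)))
  refine ⟨EuclideanSpace ℝ (Fin (n - 1)), UniformSpace.toTopologicalSpace, T25Space.t2Space,
    secondCountable_of_proper, chartedSpaceSelf _, inferInstance, hΦ.fibreMetric, Ioo (-δ) δ,
    IsAdaptedParam.warping (I := 𝓡 n) Φ v₀, Φ, hp, hΦ.target_subset,
    hΦ.isWarpedProduct h hμ hv₀, hΦ.isConsistent h, ?_⟩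
  rintro ⟨c, hc⟩
  -- A constant warping function would make λ constant on the neighborhood `Φ.target` of `p`.
  exact hlam _ (Φ.open_target.mem_nhds hp)
    ⟨_, hΦ.eigenvalue_const_of_warping_const h hμ hv₀ hc⟩
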